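/- Let $p_0=(0,0)$, $p_1=(1,0)$, $p_2=(1/2,\sqrt3/2)$ in $\mathbb R^2$ and $f_i(x)=(x+p_i)/2$ for $i=0,1,2$. The Sierpiński gasket $K$ is the unique non-empty compact subset of $\mathbb R^2$ with $K=f_0(K)\cup f_1(K)\cup f_2(K)$. Put $\alpha=\log 3/\log 2$, let $|\cdot|$ be the Euclidean norm, and let $\nu$ be the normalized $\alpha$-dimensional Hausdorff measure on $K$, i.e. $\nu(A)=\mathcal H^\alpha(A\cap K)/\mathcal H^\alpha(K)$. For $n\ge1$ let $W_n=\{0,1,2\}^n$ be the set of words $w=w_1\cdots w_n$, and for $w\in W_n$ let $V_w=f_{w_1}\circ\cdots\circ f_{w_n}(\{p_0,p_1,p_2\})\subseteq K$. For $\beta>\alpha$ and a continuous function $u:K\to\mathbb R$ define, with values in $[0,+\infty]$, $$E_\beta(u,u)=\sum_{n=1}^\infty 2^{(\beta-\alpha)n}\sum_{w\in W_n}\sum_{p,q\in V_w}(u(p)-u(q))^2,\qquad \mathcal E_\beta(u,u)=\int_K\int_K\frac{(u(x)-u(y))^2}{|x-y|^{\alpha+\beta}}\,\nu(dx)\,\nu(dy).$$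 **Theorem.** For every $\beta\in(\alpha,+\infty)$ there is a constant $C\in(0,\infty)$, depending only on $\beta$, such that for every continuous $u:K\to\mathbb R$ $$E_\beta(u,u)\le C\,\mathcal E_\beta(u,u)\quad\text{and}\quad \mathcal E_\beta(u,u)\le C\,E_\beta(u,u).$$ In particular, one of the two quantities is finite if and only if the other is. -/

import Mathlib

open MeasureTheory
open scoped ENNReal NNReal

noncomputable section

namespace SierpinskiGasket

/-- The Euclidean plane. -/
abbrev Plane : Type := EuclideanSpace ℝ (Fin 2)

/-- The three corners `p₀ = (0, 0)`, `p₁ = (1, 0)`, `p₂ = (1/2, √3/2)`. -/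
def corner : Fin 3 → Plane :=
  ![!₂[0, 0], !₂[1, 0], !₂[1 / 2, Real.sqrt 3 / 2]]

/-- The contractions `f i x = (x + p i) / 2`. -/
def contraction (i : Fin 3) (x : Plane) : Plane :=
  (2⁻¹ : ℝ) • (x + corner i)

/-- `K` is a non-empty compact set with `K = f₀(K) ∪ f₁(K) ∪ f₂(K)`. -/
def IsAttractor (K : Set Plane) : Prop :=
  K.Nonempty ∧ IsCompact K ∧ K = ⋃ i, contraction i '' K

theorem dist_contraction (i : Fin 3) (x y : Plane) :
    dist (contraction i x) (contraction i y) = 2⁻¹ * dist x y := by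
  simp [contraction, dist_smul₀]

theorem IsAttractor.subset {K L : Set Plane} (hK : IsAttractor K) (hL : IsAttractor L) :
    K ⊆ L := by
  obtain ⟨hKn, hKc, hKe⟩ := hK
  obtain ⟨hLn, hLc, hLe⟩ := hL
  obtain ⟨x, hx, hmax⟩ :=
    hKc.exists_isMaxOn hKn (Metric.continuous_infDist_pt L).continuousOn
  have hx' := hx
  rw [hKe] at hx'
  obtain ⟨i, y, hy, rfl⟩ := Set.mem_iUnion.1 hx'
  obtain ⟨z, hz, hyz⟩ := hLc.exists_infDist_eq_dist hLn y
  have hzL : contraction i z ∈ L := by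
    rw [hLe]
    exact Set.mem_iUnion.2 ⟨i, z, hz, rfl⟩
  have h1 : Metric.infDist (contraction i y) L ≤ 2⁻¹ * Metric.infDist y L := by
    rw [hyz, ← dist_contraction]
    exact Metric.infDist_le_dist_of_mem hzL
  have h2 : Metric.infDist y L ≤ Metric.infDist (contraction i y) L := hmax hy
  intro a ha
  have h3 : Metric.infDist a L ≤ Metric.infDist (contraction i y) L := hmax ha
  have h4 : Metric.infDist a L = 0 :=
    le_antisymm (by linarith) Metric.infDist_nonneg
  exact (hLc.isClosed.mem_iff_infDist_zero hLn).2 h4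

theorem summable_coding (w : ℕ → Fin 3) :
    Summable fun k => ((2⁻¹ : ℝ) ^ (k + 1)) • corner (w k) := by
  obtain ⟨M, hM⟩ := (Set.finite_range fun i => ‖corner i‖).bddAbove
  refine Summable.of_norm_bounded (g := fun k => (2⁻¹ : ℝ) ^ (k + 1) * M) ?_ ?_
  · exact ((summable_nat_add_iff 1).2
      (summable_geometric_of_lt_one (by norm_num) (by norm_num))).mul_right M
  · intro k
    rw [norm_smul, Real.norm_of_nonneg (by positivity)]
    exact mul_le_mul_of_nonneg_left (hM ⟨w k, rfl⟩) (by positivity)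

theorem exists_isAttractor : ∃ K, IsAttractor K := by
  let g : (ℕ → Fin 3) → Plane := fun w => ∑' k, ((2⁻¹ : ℝ) ^ (k + 1)) • corner (w k)
  have hg : Continuous g := by
    obtain ⟨M, hM⟩ := (Set.finite_range fun i => ‖corner i‖).bddAbove
    refine continuous_tsum (u := fun k => (2⁻¹ : ℝ) ^ (k + 1) * M) ?_ ?_ ?_
    · intro k
      have hc : Continuous corner := continuous_of_discreteTopology
      exact (hc.comp (continuous_apply k : Continuous fun w : ℕ → Fin 3 => w k)).const_smul ((2⁻¹ : ℝ) ^ (k + 1))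
    · exact ((summable_nat_add_iff 1).2
        (summable_geometric_of_lt_one (by norm_num) (by norm_num))).mul_right M
    · intro k w
      rw [norm_smul, Real.norm_of_nonneg (by positivity)]
      exact mul_le_mul_of_nonneg_left (hM ⟨w k, rfl⟩) (by positivity)
  have hrec : ∀ w, g w = contraction (w 0) (g fun k => w (k + 1)) := by
    intro w
    have h := (summable_coding w).tsum_eq_zero_add
    have h2 : (∑' k, ((2⁻¹ : ℝ) ^ (k + 1 + 1)) • corner (w (k + 1)))
        = (2⁻¹ : ℝ) • ∑' k, ((2⁻¹ : ℝ) ^ (k + 1)) • corner (w (k + 1)) := by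
      rw [← (summable_coding fun k => w (k + 1)).tsum_const_smul]
      congr 1
      funext k
      rw [smul_smul, pow_succ' _ (k + 1)]
    change (∑' k, ((2⁻¹ : ℝ) ^ (k + 1)) • corner (w k)) = _
    rw [h, h2]
    simp only [contraction, g, smul_add]
    rw [add_comm]
    simp
  refine ⟨Set.range g, Set.range_nonempty g, isCompact_range hg, ?_⟩
  ext x
  simp only [Set.mem_iUnion, Set.mem_image, Set.mem_range, exists_exists_eq_and]
  constructor
  · rintro ⟨w, rfl⟩
    exact ⟨w 0, fun k => w (k + 1), (hrec w).symm⟩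
  · rintro ⟨i, w, rfl⟩
    let v : ℕ → Fin 3 := fun k => Nat.casesOn k i w
    exact ⟨v, hrec v⟩

theorem existsUnique_isAttractor : ∃! K, IsAttractor K := by
  obtain ⟨K, hK⟩ := exists_isAttractor
  exact ⟨K, hK, fun L hL => Set.Subset.antisymm (hL.subset hK) (hK.subset hL)⟩

/-- The Sierpinski gasket: the unique non-empty compact set `K` such that
`K = f₀(K) ∪ f₁(K) ∪ f₂(K)`. -/
def gasket : Set Plane := existsUnique_isAttractor.choose

theorem gasket_isAttractor : IsAttractor gasket := existsUnique_isAttractor.choose_spec.1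

/-- The Hausdorff dimension `α = log 3 / log 2` of the gasket. -/
def alpha : ℝ := Real.log 3 / Real.log 2

/-- The normalized `α`-dimensional Hausdorff measure on the gasket, as a measure on the plane. -/
def nu : Measure Plane := (μH[alpha] gasket)⁻¹ • (μH[alpha]).restrict gasket

/-- The map `f_{w₁} ∘ ⋯ ∘ f_{wₙ}` of a word `w = w₁ … wₙ` of length `n`. -/
def wordMap : {n : ℕ} → (Fin n → Fin 3) → Plane → Plane
  | 0, _ => id
  | _ + 1, w => contraction (w 0) ∘ wordMap (fun k => w k.succ)

open Classical in
/-- The vertex set `V_w = f_{w₁} ∘ ⋯ ∘ f_{wₙ} ({p₀, p₁, p₂})`. -/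
def cellVertices {n : ℕ} (w : Fin n → Fin 3) : Finset Plane :=
  (Finset.univ.image corner).image (wordMap w)

/-- `∑_{w ∈ W_n} ∑_{p, q ∈ V_w} (u(p) - u(q))²`. -/
def levelSum (n : ℕ) (u : Plane → ℝ) : ℝ :=
  ∑ w : Fin n → Fin 3, ∑ p ∈ cellVertices w, ∑ q ∈ cellVertices w, (u p - u q) ^ 2

/-- The discrete semi-norm `∑_{n ≥ 1} 2^((β - α) n) ∑_{w ∈ W_n} ∑_{p, q ∈ V_w} (u(p) - u(q))²`,
with values in `[0, ∞]`; the summation index is shifted by one. -/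
def discreteEnergy (β : ℝ) (u : Plane → ℝ) : ℝ≥0∞ :=
  ∑' n : ℕ, ENNReal.ofReal ((2 : ℝ) ^ ((β - alpha) * ((n + 1 : ℕ) : ℝ)) * levelSum (n + 1) u)

/-- The energy `∬ (u(x) - u(y))² / |x - y|^(α + β) ν(dx) ν(dy)`, with values in `[0, ∞]`. -/
def integralEnergy (β : ℝ) (u : Plane → ℝ) : ℝ≥0∞ :=
  ∫⁻ y, ∫⁻ x, ENNReal.ofReal ((u x - u y) ^ 2 / dist x y ^ (alpha + β)) ∂nu ∂nu

end SierpinskiGasket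

end

/-! Write R = 2^(β-α) = 2^β/3, so 2^(α+β) = 9R, and let D_n be the level-n sum of squared vertex
differences (`vertexSumLevel`). The discrete energy is the sum of R^n D_n over n ≥ 1. The integral
energy is compared with sums of (9R)^n times double integrals over pairs of level-n cells; every
level-n cell has ν-mass 3^(-n) (`nu_cell`). Both directions telescope u along a sequence of points
in nested cells, with a weighted Cauchy-Schwarz inequality (`sq_sub_le_tsum_of_tendsto`): a weight
μ^j with μ > 1 pays for the infinitely many steps, and μ stays below the growth rate of the energy,
so that the resulting double series is summable (`tsum_tsum_pow_mul_le`).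

Discrete by integral: choose in each cell a point whose mean squared difference to the cell is at
most the average. Such points in the cells of w, wi, wii, … converge to the i-th vertex of w, and
each step is controlled by a double integral over one cell (`vertexSumLevel_le`). Conversely, two
points at distance r lie together in boundedly many cells of each level, and only at levels with 2^m
r ≤ diam K, so summing (9R)^m over those levels gives at most a constant times r^(-(α+β))
(`tsum_pairIntegralLevel_le`). The condition β > α, that is R > 1, leaves room for 1 < μ < R.

Integral by discrete: points at distance comparable to 2^(-n) lie in level-n cells that share a
vertex p (`Adjacent.exists_wordMap_corner_eq`). Compare u(x) and u(y) with u(p), and telescope from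
p to x through vertices of the cells along an address of x, consecutive vertices lying in one common
cell (`sq_sub_code_le_tsum`). Here 1 < μ < 2^β suffices. The missing term D_0 is bounded by D_1
(`vertexSumLevel_zero_le`).

All cell combinatorics is integer arithmetic: in barycentric coordinates a level-n cell is a copy of
K scaled by 2^(-n) and translated by a lattice vector (`bary_wordMap`). -/

noncomputable section

namespace SierpinskiGasket

/-! ### Barycentric coordinates -/

/-- The barycentric coordinates with respect to the three corners. -/
def bary (i : Fin 3) (x : Plane) : ℝ :=
  ![1 - x 0 - x 1 / √3, x 0 - x 1 / √3, 2 * (x 1 / √3)] i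

theorem bary_corner (i j : Fin 3) : bary i (corner j) = if i = j then 1 else 0 := by
  have h : √3 / 2 / √3 = (1 / 2 : ℝ) := by
    have : √3 ≠ (0 : ℝ) := by positivity
    field_simp
  fin_cases i <;> fin_cases j <;> (simp [bary, corner, h]; try norm_num)

theorem bary_contraction (i j : Fin 3) (x : Plane) :
    bary i (contraction j x) = (bary i x + if i = j then 1 else 0) / 2 := by
  rw [← bary_corner]
  fin_cases i <;> simp [bary, contraction] <;> ring

theorem sum_bary (x : Plane) : ∑ i, bary i x = 1 := by
  simp [Fin.sum_univ_three, bary]; ring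

theorem bary_ext {x y : Plane} (h : ∀ i, bary i x = bary i y) : x = y := by
  have h1 := h 1
  have h2 := h 2
  simp only [bary, Matrix.cons_val_one, Matrix.cons_val_zero, Matrix.cons_val] at h1 h2
  have hs : √3 ≠ (0 : ℝ) := by positivity
  have e1 : x 1 / √3 = y 1 / √3 := by linarith
  ext k
  fin_cases k
  · change x 0 = y 0
    linarith
  · exact (div_left_inj' hs).1 e1

/-- The Lipschitz constant 2 fixes the threshold 1/2 in `adjacent_of_dist_lt`. -/
theorem abs_bary_sub_le (i : Fin 3) (x y : Plane) : |bary i x - bary i y| ≤ 2 * dist x y := by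
  have h0 : |x 0 - y 0| ≤ dist x y := by
    simpa [dist_eq_norm] using PiLp.norm_apply_le (x - y) 0
  have h1 : |x 1 - y 1| ≤ dist x y := by
    simpa [dist_eq_norm] using PiLp.norm_apply_le (x - y) 1
  have hs : (1 : ℝ) ≤ √3 := Real.one_le_sqrt.2 (by norm_num)
  have h2 : |x 1 / √3 - y 1 / √3| ≤ dist x y := by
    rw [← sub_div, abs_div, abs_of_nonneg (Real.sqrt_nonneg 3)]
    exact (div_le_self (abs_nonneg _) hs).trans h1
  rw [abs_le] at *
  fin_cases i <;> simp [bary] <;> constructor <;> linarith [h0.1, h0.2, h2.1, h2.2]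

theorem continuous_bary (i : Fin 3) : Continuous (bary i) := by
  refine continuous_iff_continuousAt.2 fun x => ?_
  refine tendsto_iff_dist_tendsto_zero.2 ?_
  refine squeeze_zero (fun _ => dist_nonneg) (fun y => abs_bary_sub_le i y x) ?_
  have : Filter.Tendsto (fun y => 2 * dist y x) (nhds x) (nhds (2 * dist x x)) :=
    Continuous.tendsto (by fun_prop) x
  simpa using this

theorem isCompact_gasket : IsCompact gasket := gasket_isAttractor.2.1

theorem gasket_nonempty : gasket.Nonempty := gasket_isAttractor.1

theorem contraction_mem_gasket {x : Plane} (i : Fin 3) (hx : x ∈ gasket) :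
    contraction i x ∈ gasket := by
  rw [gasket_isAttractor.2.2]
  exact Set.mem_iUnion.2 ⟨i, x, hx, rfl⟩

theorem exists_contraction_eq {x : Plane} (hx : x ∈ gasket) :
    ∃ i, ∃ y ∈ gasket, contraction i y = x := by
  rw [gasket_isAttractor.2.2] at hx
  simpa using hx

/-- Minimum principle: if the minimum m over K is attained at `contraction j y`, then m is half of
`bary i y` plus 0 or 1/2, hence m ≥ m/2 and m ≥ 0. -/
theorem bary_nonneg {x : Plane} (hx : x ∈ gasket) (i : Fin 3) : 0 ≤ bary i x := by
  obtain ⟨z, hz, hmin⟩ :=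
    isCompact_gasket.exists_isMinOn gasket_nonempty (continuous_bary i).continuousOn
  obtain ⟨j, y, hy, rfl⟩ := exists_contraction_eq hz
  have h1 : bary i (contraction j y) ≤ bary i y := hmin hy
  have h2 : bary i (contraction j y) ≤ bary i x := hmin hx
  rw [bary_contraction] at h1 h2
  split_ifs at h1 h2 <;> linarith

theorem bary_le_one {x : Plane} (hx : x ∈ gasket) (i : Fin 3) : bary i x ≤ 1 := by
  rw [← sum_bary x]
  exact Finset.single_le_sum (f := fun i => bary i x) (fun j _ => bary_nonneg hx j)
    (Finset.mem_univ i)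

/-! ### Words -/

/-- The position of the cell of a word in the triangular lattice of mesh `2⁻ⁿ`, in barycentric
coordinates. -/
def index : {n : ℕ} → (Fin n → Fin 3) → Fin 3 → ℤ
  | 0, _, _ => 0
  | n + 1, w, i => (if i = w 0 then 2 ^ n else 0) + index (fun k => w k.succ) i

theorem index_nonneg {n : ℕ} (w : Fin n → Fin 3) (i : Fin 3) : 0 ≤ index w i := by
  induction n with
  | zero => simp [index]
  | succ n ih =>
    have := ih fun k => w k.succ
    rw [index]
    split_ifs <;> positivity

theorem sum_index {n : ℕ} (w : Fin n → Fin 3) : ∑ i, index w i = 2 ^ n - 1 := by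
  induction n with
  | zero => simp [index]
  | succ n ih =>
    simp only [index, Finset.sum_add_distrib, ih]
    simp
    ring

theorem index_lt {n : ℕ} (w : Fin n → Fin 3) (i : Fin 3) : index w i < 2 ^ n := by
  have := Finset.single_le_sum (f := fun i => index w i) (fun j _ => index_nonneg w j)
    (Finset.mem_univ i)
  rw [sum_index] at this
  omega

/-- The first letter can be read off: only its coordinate reaches 2^n, since the tail contributes
less than 2^n to every coordinate. -/
theorem index_injective (n : ℕ) :
    Function.Injective (index : (Fin n → Fin 3) → Fin 3 → ℤ) := by
  induction n with
  | zero => exact fun _ _ _ => Subsingleton.elim _ _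
  | succ n ih =>
    intro w v h
    have h0 : w 0 = v 0 := by
      by_contra hne
      have h1 := congrFun h (w 0)
      simp only [index, if_true, if_neg hne] at h1
      have h2 := index_lt (fun k => v k.succ) (w 0)
      have h3 := index_nonneg (fun k => w k.succ) (w 0)
      omega
    have ht : (fun k : Fin n => w k.succ) = fun k : Fin n => v k.succ := by
      refine ih (funext fun i => ?_)
      have h1 := congrFun h i
      simp only [index, h0] at h1
      omega
    ext k
    refine Fin.cases ?_ (fun k => ?_) k
    · rw [h0]
    · rw [congrFun ht k]

theorem bary_wordMap {n : ℕ} (w : Fin n → Fin 3) (i : Fin 3) (x : Plane) :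
    bary i (wordMap w x) = ((2 : ℝ) ^ n)⁻¹ * (bary i x + index w i) := by
  induction n with
  | zero => simp [wordMap, index]
  | succ n ih =>
    rw [wordMap, Function.comp_apply, bary_contraction, ih, index]
    have : (2 : ℝ) ^ n ≠ 0 := by positivity
    split_ifs <;> push_cast <;> field_simp <;> ring

theorem dist_wordMap {n : ℕ} (w : Fin n → Fin 3) (x y : Plane) :
    dist (wordMap w x) (wordMap w y) = ((2 : ℝ) ^ n)⁻¹ * dist x y := by
  induction n with
  | zero => simp [wordMap]
  | succ n ih =>
    rw [wordMap, Function.comp_apply, Function.comp_apply, dist_contraction, ih]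
    rw [pow_succ, mul_inv]
    ring

theorem wordMap_injective {n : ℕ} (w : Fin n → Fin 3) : Function.Injective (wordMap w) := by
  intro x y h
  have := dist_wordMap w x y
  rw [h, dist_self] at this
  have h2 : ((2 : ℝ) ^ n)⁻¹ ≠ 0 := by positivity
  exact dist_eq_zero.1 ((mul_eq_zero.1 this.symm).resolve_left h2)

theorem continuous_wordMap {n : ℕ} (w : Fin n → Fin 3) : Continuous (wordMap w) :=
  (LipschitzWith.of_dist_le_mul (K := (2 ^ n)⁻¹) fun x y => by
    simp [dist_wordMap]).continuous

theorem wordMap_mem_gasket {n : ℕ} (w : Fin n → Fin 3) {x : Plane} (hx : x ∈ gasket) :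
    wordMap w x ∈ gasket := by
  induction n with
  | zero => exact hx
  | succ n ih => exact contraction_mem_gasket _ (ih _)

theorem corner_injective : Function.Injective corner := by
  intro i j h
  have := bary_corner i j
  rw [← h, bary_corner] at this
  by_contra hne
  simp [hne] at this

theorem wordMap_succ {n : ℕ} (w : Fin (n + 1) → Fin 3) (x : Plane) :
    wordMap w x = contraction (w 0) (wordMap (fun k => w k.succ) x) := rfl

/-- `wordMap` recurses on the first, outermost letter, whereas refining a cell adds a last,
innermost one. -/
theorem wordMap_snoc {n : ℕ} (w : Fin n → Fin 3) (i : Fin 3) (x : Plane) :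
    wordMap (Fin.snoc w i : Fin (n + 1) → Fin 3) x = wordMap w (contraction i x) := by
  induction n with
  | zero => simp [wordMap, Fin.snoc]
  | succ n ih =>
    have h : (fun k : Fin (n + 1) => (Fin.snoc w i : Fin (n + 2) → Fin 3) k.succ)
        = Fin.snoc (fun k => w k.succ) i := by
      ext k
      refine Fin.lastCases ?_ (fun k => ?_) k
      · rw [Fin.succ_last]; simp
      · rw [Fin.succ_castSucc, Fin.snoc_castSucc, Fin.snoc_castSucc]
    have h0 : (Fin.snoc w i : Fin (n + 2) → Fin 3) 0 = w 0 :=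
      Fin.snoc_castSucc (α := fun _ => Fin 3) i w 0
    rw [wordMap_succ, wordMap_succ w, h, h0, ih]

theorem wordMap_append {n m : ℕ} (w : Fin n → Fin 3) (v : Fin m → Fin 3) (x : Plane) :
    wordMap (Fin.append w v) x = wordMap w (wordMap v x) := by
  induction m generalizing x with
  | zero =>
    rw [Subsingleton.elim v Fin.elim0, Fin.append_elim0]
    rfl
  | succ m ih =>
    obtain ⟨v', i, rfl⟩ : ∃ (v' : Fin m → Fin 3) (i : Fin 3), v = Fin.snoc v' i :=
      ⟨Fin.init v, v (Fin.last m), (Fin.snoc_init_self v).symm⟩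
    have h : Fin.append w (Fin.snoc v' i : Fin (m + 1) → Fin 3)
        = (Fin.snoc (Fin.append w v') i : Fin (n + m + 1) → Fin 3) := Fin.append_snoc w v' i
    rw [wordMap_snoc v' i x, ← ih v' (contraction i x)]
    exact (congrArg (fun z : Fin (n + m + 1) → Fin 3 => wordMap z x) h).trans
      (wordMap_snoc (Fin.append w v') i x)

theorem contraction_corner (i : Fin 3) : contraction i (corner i) = corner i := by
  rw [contraction, ← two_smul ℝ, smul_smul]
  norm_num

/-! ### The coding of the gasket by infinite words -/

/-- The point of the gasket with a given infinite address. -/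
def code (ω : ℕ → Fin 3) : Plane := ∑' k, ((2⁻¹ : ℝ) ^ (k + 1)) • corner (ω k)

theorem continuous_code : Continuous code := by
  obtain ⟨M, hM⟩ := (Set.finite_range fun i => ‖corner i‖).bddAbove
  refine continuous_tsum (u := fun k => (2⁻¹ : ℝ) ^ (k + 1) * M) ?_ ?_ ?_
  · intro k
    have hc : Continuous corner := continuous_of_discreteTopology
    exact (hc.comp (continuous_apply k : Continuous fun w : ℕ → Fin 3 => w k)).const_smul
      ((2⁻¹ : ℝ) ^ (k + 1))
  · exact ((summable_nat_add_iff 1).2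
      (summable_geometric_of_lt_one (by norm_num) (by norm_num))).mul_right M
  · intro k w
    rw [norm_smul, Real.norm_of_nonneg (by positivity)]
    exact mul_le_mul_of_nonneg_left (hM ⟨w k, rfl⟩) (by positivity)

theorem code_eq_contraction (ω : ℕ → Fin 3) :
    code ω = contraction (ω 0) (code fun k => ω (k + 1)) := by
  have h := (summable_coding ω).tsum_eq_zero_add
  have h2 : (∑' k, ((2⁻¹ : ℝ) ^ (k + 1 + 1)) • corner (ω (k + 1)))
      = (2⁻¹ : ℝ) • ∑' k, ((2⁻¹ : ℝ) ^ (k + 1)) • corner (ω (k + 1)) := by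
    rw [← (summable_coding fun k => ω (k + 1)).tsum_const_smul]
    congr 1
    funext k
    rw [smul_smul, pow_succ' _ (k + 1)]
  rw [code, h, h2, contraction, smul_add, add_comm, code]
  simp

theorem range_code : Set.range code = gasket := by
  refine existsUnique_isAttractor.unique ⟨Set.range_nonempty _, isCompact_range continuous_code, ?_⟩
    gasket_isAttractor
  ext x
  simp only [Set.mem_iUnion, Set.mem_image, Set.mem_range, exists_exists_eq_and]
  constructor
  · rintro ⟨ω, rfl⟩
    exact ⟨ω 0, fun k => ω (k + 1), (code_eq_contraction ω).symm⟩
  · rintro ⟨i, ω, rfl⟩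
    let v : ℕ → Fin 3 := fun k => Nat.casesOn k i ω
    exact ⟨v, code_eq_contraction v⟩

theorem code_mem_gasket (ω : ℕ → Fin 3) : code ω ∈ gasket := by
  rw [← range_code]
  exact ⟨ω, rfl⟩

theorem code_eq_wordMap (n : ℕ) (ω : ℕ → Fin 3) :
    code ω = wordMap (fun k : Fin n => ω k) (code fun k => ω (k + n)) := by
  induction n generalizing ω with
  | zero => rfl
  | succ n ih =>
    rw [code_eq_contraction, ih]
    simp only [wordMap, Function.comp_apply, add_assoc, Fin.val_succ]
    rfl

/-- Gives the vertex `wordMap w (corner i)` the address w i i i …, so that the cells of these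
prefixes shrink to it. -/
theorem code_const (i : Fin 3) : code (fun _ => i) = corner i := by
  have h := code_eq_contraction fun _ => i
  rw [contraction] at h
  have h2 : (2 : ℝ) • code (fun _ => i) = code (fun _ => i) + corner i := by
    nth_rw 1 [h]
    rw [smul_smul]
    norm_num
  rw [two_smul] at h2
  exact add_left_cancel h2

theorem corner_mem_gasket (i : Fin 3) : corner i ∈ gasket := by
  rw [← code_const]
  exact code_mem_gasket _

/-! ### Cells -/

/-- The cell `f_w (K)` of a word. -/
def cell {n : ℕ} (w : Fin n → Fin 3) : Set Plane := wordMap w '' gasket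

theorem isCompact_cell {n : ℕ} (w : Fin n → Fin 3) : IsCompact (cell w) :=
  isCompact_gasket.image (continuous_wordMap w)

theorem measurableSet_cell {n : ℕ} (w : Fin n → Fin 3) : MeasurableSet (cell w) :=
  (isCompact_cell w).isClosed.measurableSet

theorem cell_subset_gasket {n : ℕ} (w : Fin n → Fin 3) : cell w ⊆ gasket := by
  rintro _ ⟨x, hx, rfl⟩
  exact wordMap_mem_gasket w hx

theorem cell_snoc_subset {n : ℕ} (w : Fin n → Fin 3) (i : Fin 3) :
    cell (Fin.snoc w i : Fin (n + 1) → Fin 3) ⊆ cell w := by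
  rintro _ ⟨x, hx, rfl⟩
  exact ⟨contraction i x, contraction_mem_gasket i hx, (wordMap_snoc w i x).symm⟩

theorem exists_mem_cell (n : ℕ) {x : Plane} (hx : x ∈ gasket) :
    ∃ w : Fin n → Fin 3, x ∈ cell w := by
  rw [← range_code] at hx
  obtain ⟨ω, rfl⟩ := hx
  exact ⟨_, _, code_mem_gasket _, (code_eq_wordMap n ω).symm⟩

theorem wordMap_corner_mem_cell {n : ℕ} (w : Fin n → Fin 3) (i : Fin 3) :
    wordMap w (corner i) ∈ cell w :=
  ⟨_, corner_mem_gasket i, rfl⟩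

/-- The diameter of the gasket. -/
def diameter : ℝ := Metric.diam gasket

theorem dist_le_of_mem_cell {n : ℕ} {w : Fin n → Fin 3} {x y : Plane} (hx : x ∈ cell w)
    (hy : y ∈ cell w) : dist x y ≤ ((2 : ℝ) ^ n)⁻¹ * diameter := by
  obtain ⟨x, hx, rfl⟩ := hx
  obtain ⟨y, hy, rfl⟩ := hy
  rw [dist_wordMap]
  gcongr
  exact Metric.dist_le_diam_of_mem isCompact_gasket.isBounded hx hy

/-- Two words of the same length are adjacent if their lattice positions differ by at most one in
every coordinate. -/
def Adjacent {n : ℕ} (w v : Fin n → Fin 3) : Prop := ∀ i, |index w i - index v i| ≤ 1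

theorem Adjacent.symm {n : ℕ} {w v : Fin n → Fin 3} (h : Adjacent w v) : Adjacent v w :=
  fun i => abs_sub_comm (index w i) _ ▸ h i

/-- The vertices of a cell have scaled barycentric coordinates `index w` plus a unit vector.
Positions at one level have equal coordinate sums, so a difference with entries in {-1, 0, 1} is 0
or a difference of two unit vectors, which is a common vertex. -/
theorem Adjacent.exists_wordMap_corner_eq {n : ℕ} {w v : Fin n → Fin 3} (h : Adjacent w v) :
    ∃ i j, wordMap w (corner i) = wordMap v (corner j) := by
  have key : ∃ i j : Fin 3, ∀ k, (if k = i then 1 else 0) + index w k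
      = (if k = j then 1 else 0) + index v k := by
    have hs : ∑ i, index w i = ∑ i, index v i := by rw [sum_index, sum_index]
    simp only [Fin.sum_univ_three] at hs
    have h0 := abs_le.1 (h 0)
    have h1 := abs_le.1 (h 1)
    have h2 := abs_le.1 (h 2)
    have h3 {z : ℤ} (hz : -1 ≤ z ∧ z ≤ 1) : z = -1 ∨ z = 0 ∨ z = 1 := by omega
    have hk (i j : Fin 3) (e : (if 0 = i then 1 else 0) + index w 0
        = (if 0 = j then 1 else 0) + index v 0) (e' : (if 1 = i then 1 else 0) + index w 1
        = (if 1 = j then 1 else 0) + index v 1) (e'' : (if 2 = i then 1 else 0) + index w 2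
        = (if 2 = j then 1 else 0) + index v 2) : ∃ i j : Fin 3, ∀ k,
        (if k = i then 1 else 0) + index w k = (if k = j then 1 else 0) + index v k :=
      ⟨i, j, fun k => by fin_cases k <;> assumption⟩
    -- The third difference is determined by the first two; the combinations (-1, -1) and (1, 1)
    -- would force it to be ±2.
    rcases h3 h0 with h0 | h0 | h0 <;> rcases h3 h1 with h1 | h1 | h1
    · omega
    · exact hk 0 2 (by simp; omega) (by simp; omega) (by simp; omega)
    · exact hk 0 1 (by simp; omega) (by simp; omega) (by simp; omega)
    · exact hk 1 2 (by simp; omega) (by simp; omega) (by simp; omega)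
    · exact hk 0 0 (by simp; omega) (by simp; omega) (by simp; omega)
    · exact hk 2 1 (by simp; omega) (by simp; omega) (by simp; omega)
    · exact hk 1 0 (by simp; omega) (by simp; omega) (by simp; omega)
    · exact hk 2 0 (by simp; omega) (by simp; omega) (by simp; omega)
    · omega
  obtain ⟨i, j, hij⟩ := key
  refine ⟨i, j, bary_ext fun k => ?_⟩
  rw [bary_wordMap, bary_wordMap, bary_corner, bary_corner]
  have := hij k
  congr 1
  exact_mod_cast this

/-- After scaling by 2^n, the distance accounts for 2r and the positions inside the two cells, with
coordinates in [0, 1], for 1. -/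
theorem abs_index_sub_le {n : ℕ} {w v : Fin n → Fin 3} {x y : Plane} {r : ℝ} (hx : x ∈ cell w)
    (hy : y ∈ cell v) (h : 2 ^ n * dist x y ≤ r) (i : Fin 3) :
    ((|index w i - index v i| : ℤ) : ℝ) ≤ 1 + 2 * r := by
  obtain ⟨x, hx, rfl⟩ := hx
  obtain ⟨y, hy, rfl⟩ := hy
  have h1 := abs_bary_sub_le i (wordMap w x) (wordMap v y)
  rw [bary_wordMap, bary_wordMap, ← mul_sub, abs_mul,
    abs_of_nonneg (by positivity), inv_mul_le_iff₀ (by positivity)] at h1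
  have h2 : |bary i x + index w i - (bary i y + index v i)| ≤ 2 * r := by linarith
  have := bary_nonneg hx i
  have := bary_le_one hx i
  have := bary_nonneg hy i
  have := bary_le_one hy i
  push_cast
  rw [abs_le] at *
  constructor <;> linarith

theorem adjacent_of_dist_lt {n : ℕ} {w v : Fin n → Fin 3} {x y : Plane} (hx : x ∈ cell w)
    (hy : y ∈ cell v) (h : 2 ^ n * dist x y < 2⁻¹) : Adjacent w v := by
  intro i
  have h1 := abs_index_sub_le hx hy le_rfl i
  have h2 : ((|index w i - index v i| : ℤ) : ℝ) < (2 : ℤ) := by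
    push_cast at h1 ⊢
    linarith
  have := Int.cast_lt.1 h2
  omega

theorem adjacent_of_mem_cell {n : ℕ} {w v : Fin n → Fin 3} {x : Plane} (hx : x ∈ cell w)
    (hy : x ∈ cell v) : Adjacent w v :=
  adjacent_of_dist_lt hx hy (by simp)

-- Injectivity of `index` reduces this to counting lattice points in a cube. The bound is crude;
-- what matters is that it does not depend on n.
open Classical in
theorem card_index_near_le {n : ℕ} (w : Fin n → Fin 3) (r : ℕ) :
    (Finset.univ.filter fun v : Fin n → Fin 3 => ∀ i, |index v i - index w i| ≤ r).card
      ≤ (2 * r + 1) ^ 3 := by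
  calc _ ≤ (Fintype.piFinset fun i => Finset.Icc (index w i - r) (index w i + r)).card := by
        refine Finset.card_le_card_of_injOn index ?_ (index_injective n).injOn
        intro v hv
        simp only [Finset.coe_filter, Finset.mem_univ, true_and, Set.mem_ofPred_eq] at hv
        simp only [Finset.mem_coe, Fintype.mem_piFinset, Finset.mem_Icc]
        intro i
        have := abs_le.1 (hv i)
        omega
    _ = _ := by
        rw [Fintype.card_piFinset]
        have h (i : Fin 3) : (Finset.Icc (index w i - r) (index w i + r)).card = 2 * r + 1 := by
          rw [Int.card_Icc]
          omega
        simp [h]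

open Classical in
theorem card_adjacent_le {n : ℕ} (w : Fin n → Fin 3) :
    (Finset.univ.filter fun v => Adjacent v w).card ≤ 27 := by
  refine le_trans (le_of_eq ?_) (card_index_near_le w 1)
  simp only [Adjacent]
  congr

/-! ### The Hausdorff measure of the gasket -/

theorem alpha_pos : 0 < alpha := div_pos (Real.log_pos (by norm_num)) (Real.log_pos (by norm_num))

theorem two_rpow_alpha : (2 : ℝ) ^ alpha = 3 := by
  rw [Real.rpow_def_of_pos (by norm_num), alpha, mul_div_cancel₀ _ (Real.log_pos (by norm_num)).ne',
    Real.exp_log (by norm_num)]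

theorem two_pow_rpow_alpha (n : ℕ) : ((2 : ℝ) ^ n) ^ alpha = 3 ^ n := by
  rw [← Real.rpow_natCast, ← Real.rpow_mul (by norm_num), mul_comm, Real.rpow_mul (by norm_num),
    two_rpow_alpha, Real.rpow_natCast]

theorem two_pow_inv_rpow_alpha (n : ℕ) : (((2 : ℝ) ^ n)⁻¹) ^ alpha = (3 ^ n)⁻¹ := by
  rw [Real.inv_rpow (by positivity), two_pow_rpow_alpha]

theorem gasket_subset_iUnion_cell (n : ℕ) : gasket ⊆ ⋃ w : Fin n → Fin 3, cell w := fun _ hx =>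
  Set.mem_iUnion.2 (exists_mem_cell n hx)

theorem diameter_nonneg : 0 ≤ diameter := Metric.diam_nonneg

theorem ediam_cell_le {n : ℕ} (w : Fin n → Fin 3) :
    Metric.ediam (cell w) ≤ ENNReal.ofReal (((2 : ℝ) ^ n)⁻¹ * diameter) := by
  refine Metric.ediam_le fun x hx y hy => ?_
  rw [edist_dist]
  exact ENNReal.ofReal_le_ofReal (dist_le_of_mem_cell hx hy)

/-- The 3^n cells of level n cover K, and since 2^α = 3 their diameters to the power α sum to at
most diam(K)^α at every level. -/
theorem hausdorffMeasure_gasket_lt_top : μH[alpha] gasket < ∞ := by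
  have hr : Filter.Tendsto (fun n : ℕ => ENNReal.ofReal (((2 : ℝ) ^ n)⁻¹ * diameter)) Filter.atTop
      (nhds 0) := by
    rw [← ENNReal.ofReal_zero]
    refine ENNReal.tendsto_ofReal ?_
    simpa [inv_pow] using (tendsto_pow_atTop_nhds_zero_of_lt_one (r := (2⁻¹ : ℝ)) (by norm_num)
      (by norm_num)).mul_const diameter
  refine (Measure.hausdorffMeasure_le_liminf_sum alpha gasket _ hr
    (fun n (w : Fin n → Fin 3) => cell w) (Filter.Eventually.of_forall fun n w => ediam_cell_le w)
    (Filter.Eventually.of_forall gasket_subset_iUnion_cell)).trans_lt ?_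
  refine lt_of_le_of_lt ?_ (ENNReal.ofReal_lt_top (r := diameter ^ alpha))
  refine Filter.liminf_le_of_frequently_le' (Filter.Frequently.of_forall fun n => ?_)
  calc ∑ w : Fin n → Fin 3, Metric.ediam (cell w) ^ alpha
      ≤ ∑ _w : Fin n → Fin 3, ENNReal.ofReal ((3 ^ n)⁻¹ * diameter ^ alpha) := by
        refine Finset.sum_le_sum fun w _ => ?_
        rw [← two_pow_inv_rpow_alpha, ← Real.mul_rpow (by positivity) diameter_nonneg,
          ← ENNReal.ofReal_rpow_of_nonneg (mul_nonneg (by positivity) diameter_nonneg)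
            alpha_pos.le]
        exact ENNReal.rpow_le_rpow (ediam_cell_le w) alpha_pos.le
    _ = ENNReal.ofReal (diameter ^ alpha) := by
        simp only [Finset.sum_const, Finset.card_univ, Fintype.card_pi, Fintype.card_fin,
          Finset.prod_const, nsmul_eq_mul]
        rw [← ENNReal.ofReal_natCast, ← ENNReal.ofReal_mul (by positivity)]
        push_cast
        rw [← mul_assoc, mul_inv_cancel₀ (by positivity), one_mul]

/-- The uniform Bernoulli measure on infinite words. -/
def bernoulli : Measure (ℕ → Fin 3) :=
  Measure.infinitePi fun _ => (PMF.uniformOfFintype (Fin 3)).toMeasure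

instance : IsProbabilityMeasure bernoulli := by
  unfold bernoulli
  infer_instance

theorem bernoulli_cylinder {n : ℕ} (w : Fin n → Fin 3) :
    bernoulli {ω | ∀ k : Fin n, ω k = w k} = (3 ^ n)⁻¹ := by
  have h : {ω : ℕ → Fin 3 | ∀ k : Fin n, ω k = w k}
      = Set.pi (Finset.range n) fun k => {if h : k < n then w ⟨k, h⟩ else 0} := by
    ext ω
    simp only [Set.mem_ofPred_eq, Set.mem_pi, Finset.coe_range, Set.mem_Iio,
      Set.mem_singleton_iff]
    constructor
    · intro h k hk
      rw [dif_pos hk, ← h ⟨k, hk⟩]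
    · intro h k
      rw [h k k.2, dif_pos k.2]
  rw [h, bernoulli, Measure.infinitePi_pi _ fun _ _ => measurableSet_singleton _]
  simp only [PMF.toMeasure_apply_singleton _ _ (measurableSet_singleton _),
    PMF.uniformOfFintype_apply, Finset.prod_const, Finset.card_range, Fintype.card_fin]
  rw [ENNReal.inv_pow]
  norm_num

/-- Points of a set of diameter at most 2^(-n) have level-n positions differing by at most 3 = 1 +
2·1, so their addresses fall into at most 7^3 = 343 cylinders. The closure of `s` serves only to
have a measurable set. -/
theorem map_code_bernoulli_le {s : Set Plane} {n : ℕ}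
    (hs : Metric.ediam s ≤ ENNReal.ofReal ((2 ^ n)⁻¹)) :
    bernoulli.map code s ≤ 343 * (3 ^ n)⁻¹ := by
  classical
  have hd : Metric.ediam (closure s) ≤ ENNReal.ofReal ((2 ^ n)⁻¹) := by
    rwa [Metric.ediam_closure]
  refine (measure_mono subset_closure).trans ?_
  rw [Measure.map_apply continuous_code.measurable isClosed_closure.measurableSet]
  rcases (code ⁻¹' closure s).eq_empty_or_nonempty with he | ⟨ω₀, h₀⟩
  · simp [he]
  set w : Fin n → Fin 3 := fun k => ω₀ k
  have hsub : code ⁻¹' closure s ⊆ ⋃ v ∈ Finset.univ.filter fun v : Fin n → Fin 3 =>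
      ∀ i, |index v i - index w i| ≤ (3 : ℕ), {ω | ∀ k : Fin n, ω k = v k} := by
    intro ω hω
    simp only [Set.mem_iUnion]
    refine ⟨fun k => ω k, ?_, fun k => rfl⟩
    rw [Finset.mem_filter]
    refine ⟨Finset.mem_univ _, fun i => ?_⟩
    have hdist : 2 ^ n * dist (code ω) (code ω₀) ≤ 1 := by
      have h1 := (Metric.edist_le_ediam_of_mem (show code ω ∈ closure s from hω)
        (show code ω₀ ∈ closure s from h₀)).trans hd
      rw [edist_dist, ENNReal.ofReal_le_ofReal_iff (by positivity)] at h1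
      calc _ ≤ (2 : ℝ) ^ n * (2 ^ n)⁻¹ := by gcongr
        _ = 1 := mul_inv_cancel₀ (by positivity)
    have h2 := abs_index_sub_le (w := fun k : Fin n => ω k) (v := w)
      ⟨_, code_mem_gasket _, (code_eq_wordMap n ω).symm⟩
      ⟨_, code_mem_gasket _, (code_eq_wordMap n ω₀).symm⟩ hdist i
    have h3 : ((|index (fun k : Fin n => ω k) i - index w i| : ℤ) : ℝ) ≤ (3 : ℤ) :=
      h2.trans (by norm_num)
    exact_mod_cast h3
  calc bernoulli (code ⁻¹' closure s) ≤ _ := measure_mono hsub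
    _ ≤ ∑ v ∈ Finset.univ.filter fun v : Fin n → Fin 3 =>
        ∀ i, |index v i - index w i| ≤ (3 : ℕ), bernoulli {ω | ∀ k : Fin n, ω k = v k} :=
      measure_biUnion_finset_le _ _
    _ ≤ 343 * (3 ^ n)⁻¹ := by
      simp only [bernoulli_cylinder, Finset.sum_const, nsmul_eq_mul]
      gcongr
      exact_mod_cast card_index_near_le w 3

theorem map_code_bernoulli_le_rpow {s : Set Plane} (hs : Metric.ediam s ≤ 1) :
    bernoulli.map code s ≤ 1029 * Metric.ediam s ^ alpha := by
  obtain ⟨d, hd0, hd⟩ : ∃ d : ℝ, 0 ≤ d ∧ Metric.ediam s = ENNReal.ofReal d :=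
    ⟨(Metric.ediam s).toReal, ENNReal.toReal_nonneg,
      (ENNReal.ofReal_toReal (hs.trans_lt ENNReal.one_lt_top).ne).symm⟩
  rw [hd, ENNReal.ofReal_rpow_of_nonneg hd0 alpha_pos.le]
  rcases hd0.eq_or_lt with rfl | hpos
  · rw [Real.zero_rpow alpha_pos.ne', ENNReal.ofReal_zero, mul_zero]
    have h (n : ℕ) : bernoulli.map code s ≤ 343 * (3⁻¹) ^ n := by
      rw [← ENNReal.inv_pow]
      refine map_code_bernoulli_le ?_
      rw [hd, ENNReal.ofReal_zero]
      exact zero_le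
    have ht : Filter.Tendsto (fun n : ℕ => (343 : ℝ≥0∞) * 3⁻¹ ^ n) Filter.atTop
        (nhds (343 * 0)) :=
      ENNReal.Tendsto.const_mul (ENNReal.tendsto_pow_atTop_nhds_zero_of_lt_one
        (ENNReal.inv_lt_one.2 (by norm_num))) (Or.inr (by norm_num))
    rw [mul_zero] at ht
    exact ge_of_tendsto' ht h
  · have hd1 : d ≤ 1 := by
      rw [hd] at hs
      exact ENNReal.ofReal_le_one.1 hs
    -- Here 2^(-(n+1)) < d ≤ 2^(-n); losing one level costs a factor 3, and 1029 = 3·343.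
    obtain ⟨n, hn, hn'⟩ := exists_nat_pow_near (one_le_inv_iff₀.2 ⟨hpos, hd1⟩) one_lt_two
    refine (map_code_bernoulli_le (n := n) ?_).trans ?_
    · rw [hd]
      exact ENNReal.ofReal_le_ofReal ((le_inv_comm₀ (by positivity) hpos).1 hn)
    · have h1 : (((3 : ℝ) ^ (n + 1))⁻¹) ≤ d ^ alpha := by
        rw [← two_pow_inv_rpow_alpha]
        refine Real.rpow_le_rpow (by positivity) ?_ alpha_pos.le
        exact ((inv_lt_comm₀ hpos (by positivity)).1 hn').le
      have h2 : (343 : ℝ≥0∞) * (3 ^ n)⁻¹ = ENNReal.ofReal (1029 * (3 ^ (n + 1))⁻¹) := by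
        have : (1029 : ℝ) * (3 ^ (n + 1))⁻¹ = 343 * (3 ^ n)⁻¹ := by
          rw [pow_succ]
          field_simp
          norm_num
        rw [this, ENNReal.ofReal_mul (by norm_num), ENNReal.ofReal_inv_of_pos (by positivity),
          ENNReal.ofReal_pow (by norm_num)]
        norm_num
      rw [h2, ENNReal.ofReal_mul (by norm_num)]
      have : ENNReal.ofReal 1029 = 1029 := by norm_num
      rw [this]
      gcongr

/-- Mass distribution principle: the image of the Bernoulli measure has mass 1 on K and is at most
1029 diam^α on small sets. -/
theorem hausdorffMeasure_gasket_pos : 0 < μH[alpha] gasket := by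
  have h : (1029 : ℝ≥0∞)⁻¹ • bernoulli.map code ≤ μH[alpha] := by
    refine Measure.le_hausdorffMeasure alpha _ 1 one_pos fun s hs => ?_
    rw [Measure.smul_apply, smul_eq_mul, ENNReal.inv_mul_le_iff (by norm_num) (by norm_num)]
    exact map_code_bernoulli_le_rpow hs
  refine lt_of_lt_of_le ?_ (h gasket)
  have hp : code ⁻¹' gasket = Set.univ := Set.eq_univ_of_forall code_mem_gasket
  rw [Measure.smul_apply, Measure.map_apply continuous_code.measurable
    isCompact_gasket.isClosed.measurableSet, hp, measure_univ]
  norm_num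

theorem hausdorffMeasure_contraction_image (i : Fin 3) (s : Set Plane) :
    μH[alpha] (contraction i '' s) = 3⁻¹ * μH[alpha] s := by
  have h : contraction i = AffineMap.homothety (corner i) (2⁻¹ : ℝ) := by
    ext1 x
    rw [AffineMap.homothety_apply, contraction, vsub_eq_sub, vadd_eq_add]
    module
  rw [h, hausdorffMeasure_homothety_image alpha_pos.le _ (by norm_num)]
  have h3 : ‖(2⁻¹ : ℝ)‖₊ ^ alpha = 3⁻¹ := by
    ext
    simpa using two_pow_inv_rpow_alpha 1
  rw [h3, ENNReal.smul_def, smul_eq_mul]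
  norm_num

theorem hausdorffMeasure_cell {n : ℕ} (w : Fin n → Fin 3) :
    μH[alpha] (cell w) = (3 ^ n)⁻¹ * μH[alpha] gasket := by
  induction n with
  | zero => simp [cell, wordMap]
  | succ n ih =>
    have h : cell w = contraction (w 0) '' cell fun k => w k.succ := by
      rw [cell, cell, Set.image_image]
      rfl
    rw [h, hausdorffMeasure_contraction_image, ih, pow_succ', ENNReal.mul_inv (by norm_num)
      (by norm_num), mul_assoc]

/-- Follows from self-similar scaling alone; that distinct cells overlap in null sets is not needed.
-/
theorem nu_cell {n : ℕ} (w : Fin n → Fin 3) : nu (cell w) = (3 ^ n)⁻¹ := by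
  rw [nu, Measure.smul_apply, Measure.restrict_apply (measurableSet_cell w),
    Set.inter_eq_left.2 (cell_subset_gasket w), hausdorffMeasure_cell, smul_eq_mul, mul_left_comm,
    ENNReal.inv_mul_cancel hausdorffMeasure_gasket_pos.ne' hausdorffMeasure_gasket_lt_top.ne,
    mul_one]

instance : IsProbabilityMeasure nu where
  measure_univ := by
    rw [nu, Measure.smul_apply, Measure.restrict_apply_univ, smul_eq_mul,
      ENNReal.inv_mul_cancel hausdorffMeasure_gasket_pos.ne' hausdorffMeasure_gasket_lt_top.ne]

theorem ae_mem_gasket : ∀ᵐ x ∂nu, x ∈ gasket := by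
  have h : ∀ᵐ x ∂(μH[alpha]).restrict gasket, x ∈ gasket :=
    ae_restrict_mem isCompact_gasket.isClosed.measurableSet
  exact h.filter_mono (Measure.ae_smul_measure_le _)

/-! ### Squares and sums in `ℝ≥0∞` -/

/-- The square of a real number, as an element of `[0, ∞]`. -/
def sq (x : ℝ) : ℝ≥0∞ := ENNReal.ofReal (x ^ 2)

theorem sq_sub_comm (a b : ℝ) : sq (a - b) = sq (b - a) := by
  rw [sq, sq, sub_sq_comm]

theorem sq_sub_le (a b c : ℝ) : sq (a - c) ≤ 2 * (sq (a - b) + sq (b - c)) := by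
  have h2 : (2 : ℝ≥0∞) = ENNReal.ofReal 2 := by norm_num
  rw [sq, sq, sq, h2, ← ENNReal.ofReal_add (by positivity) (by positivity),
    ← ENNReal.ofReal_mul (by norm_num)]
  refine ENNReal.ofReal_le_ofReal ?_
  nlinarith [sq_nonneg (a - b - (b - c))]

theorem measurable_sq_sub {X : Type*} [MeasurableSpace X] {f g : X → ℝ} (hf : Measurable f)
    (hg : Measurable g) : Measurable fun x => sq (f x - g x) := by
  unfold sq
  fun_prop

/-- Sum over n first: each shift by j contributes at most ρ^j times the full sum. This absorbs the
telescoping tails in both directions of the theorem. -/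
theorem tsum_tsum_pow_mul_le (ρ : ℝ≥0∞) (h : ℕ → ℝ≥0∞) :
    ∑' n, ∑' j, ρ ^ j * h (n + j) ≤ (1 - ρ)⁻¹ * ∑' m, h m := by
  rw [ENNReal.tsum_comm, ← ENNReal.tsum_geometric, ← ENNReal.tsum_mul_right]
  refine ENNReal.tsum_le_tsum fun j => ?_
  rw [ENNReal.tsum_mul_left]
  exact mul_le_mul_right (ENNReal.tsum_comp_le_tsum_of_injective (add_left_injective j) h) _

/-- Telescoping and Cauchy-Schwarz with weights μ^(-j), whose sum is at most (1 - μ⁻¹)⁻¹. The bound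
is uniform in the number of steps and passes to the limit. -/
theorem sq_sub_le_tsum_of_tendsto {μ : ℝ} (hμ : 1 < μ) {a : ℕ → ℝ} {l : ℝ}
    (ha : Filter.Tendsto a Filter.atTop (nhds l)) :
    sq (l - a 0) ≤ ENNReal.ofReal ((1 - μ⁻¹)⁻¹) *
      ∑' j, ENNReal.ofReal μ ^ j * sq (a (j + 1) - a j) := by
  have hμ0 : 0 < μ := zero_lt_one.trans hμ
  have hμ1 : μ⁻¹ < 1 := inv_lt_one_of_one_lt₀ hμ
  have hc : Continuous sq := ENNReal.continuous_ofReal.comp (continuous_pow 2)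
  refine le_of_tendsto' ((hc.tendsto _).comp (ha.sub_const (a 0))) fun n => ?_
  have h1 : (a n - a 0) ^ 2 ≤
      (1 - μ⁻¹)⁻¹ * ∑ j ∈ Finset.range n, μ ^ j * (a (j + 1) - a j) ^ 2 := by
    rcases n.eq_zero_or_pos with rfl | hn
    · simp
    have hs := Finset.sq_sum_div_le_sum_sq_div (Finset.range n) (fun j => a (j + 1) - a j)
      (g := fun j => μ⁻¹ ^ j) fun j _ => by positivity
    rw [Finset.sum_range_sub, div_le_iff₀ (Finset.sum_pos (fun j _ => by positivity)
      (Finset.nonempty_range_iff.2 hn.ne'))] at hs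
    have hg : ∑ j ∈ Finset.range n, μ⁻¹ ^ j ≤ (1 - μ⁻¹)⁻¹ := by
      rw [← tsum_geometric_of_lt_one (by positivity) hμ1]
      exact (summable_geometric_of_lt_one (by positivity) hμ1).sum_le_tsum _
        fun j _ => by positivity
    refine hs.trans ?_
    rw [mul_comm]
    refine mul_le_mul hg (le_of_eq ?_) (Finset.sum_nonneg fun j _ => by positivity)
      (inv_nonneg.2 (by linarith))
    refine Finset.sum_congr rfl fun j _ => ?_
    rw [inv_pow, div_inv_eq_mul, mul_comm]
  refine (ENNReal.ofReal_le_ofReal h1).trans ?_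
  rw [ENNReal.ofReal_mul (inv_nonneg.2 (by linarith)),
    ENNReal.ofReal_sum_of_nonneg fun j _ => by positivity]
  gcongr
  refine le_trans (le_of_eq ?_) (ENNReal.sum_le_tsum (Finset.range n))
  refine Finset.sum_congr rfl fun j _ => ?_
  rw [ENNReal.ofReal_mul (by positivity), ENNReal.ofReal_pow hμ0.le, sq]

/-- A growing geometric sum is comparable to its last term, here at the largest M with 2^M r ≤ D,
where (2^M)^γ ≤ (D/r)^γ. This recovers the singular kernel from a sum over scales. -/
theorem tsum_ite_pow_le {γ D r : ℝ} (hγ : 0 < γ) (hD : 0 ≤ D) (hr : 0 < r) :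
    ∑' m : ℕ, (if 2 ^ m * r ≤ D then ENNReal.ofReal ((2 : ℝ) ^ γ) ^ m else 0)
      ≤ ENNReal.ofReal ((2 : ℝ) ^ γ / (2 ^ γ - 1) * D ^ γ) * ENNReal.ofReal ((r ^ γ)⁻¹) := by
  have hq : 1 < (2 : ℝ) ^ γ := Real.one_lt_rpow one_lt_two hγ
  have hex : ∃ m : ℕ, ¬ 2 ^ m * r ≤ D := by
    obtain ⟨m, hm⟩ := pow_unbounded_of_one_lt (D / r) one_lt_two
    exact ⟨m, not_le.2 ((div_lt_iff₀ hr).1 hm)⟩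
  classical
  have hz (m : ℕ) (hm : m ∉ Finset.range (Nat.find hex)) :
      (if 2 ^ m * r ≤ D then ENNReal.ofReal ((2 : ℝ) ^ γ) ^ m else 0) = 0 := by
    refine if_neg fun h => Nat.find_spec hex (le_trans ?_ h)
    rw [Finset.mem_range, not_lt] at hm
    gcongr
    norm_num
  rw [tsum_eq_sum hz]
  rcases hN : Nat.find hex with _ | M
  · simp
  have hM : 2 ^ M * r ≤ D := not_not.1 (Nat.find_min hex (m := M) (by omega))
  calc _ ≤ ∑ m ∈ Finset.range (M + 1), ENNReal.ofReal (((2 : ℝ) ^ γ) ^ m) := by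
        refine Finset.sum_le_sum fun m _ => ?_
        split_ifs
        · rw [ENNReal.ofReal_pow (by positivity)]
        · exact zero_le
    _ = ENNReal.ofReal (∑ m ∈ Finset.range (M + 1), ((2 : ℝ) ^ γ) ^ m) :=
        (ENNReal.ofReal_sum_of_nonneg fun m _ => by positivity).symm
    _ ≤ ENNReal.ofReal ((2 : ℝ) ^ γ / (2 ^ γ - 1) * (D ^ γ * (r ^ γ)⁻¹)) := by
        refine ENNReal.ofReal_le_ofReal ?_
        have h1 : ((2 : ℝ) ^ γ) ^ M ≤ D ^ γ * (r ^ γ)⁻¹ := by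
          rw [← Real.inv_rpow hr.le, ← Real.mul_rpow hD (by positivity), ← Real.rpow_natCast,
            ← Real.rpow_mul (by norm_num), mul_comm γ, Real.rpow_mul (by norm_num),
            Real.rpow_natCast]
          refine Real.rpow_le_rpow (by positivity) ?_ hγ.le
          rwa [← div_eq_mul_inv, le_div_iff₀ hr]
        rw [geom_sum_eq hq.ne']
        have h2 : 0 < (2 : ℝ) ^ γ - 1 := by linarith
        calc _ ≤ ((2 : ℝ) ^ γ) ^ (M + 1) / (2 ^ γ - 1) := by gcongr; linarith
          _ = (2 : ℝ) ^ γ / (2 ^ γ - 1) * ((2 : ℝ) ^ γ) ^ M := by rw [pow_succ]; ring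
          _ ≤ _ := by gcongr
    _ = _ := by
        have h2 : 0 < (2 : ℝ) ^ γ - 1 := by linarith
        rw [← mul_assoc, ENNReal.ofReal_mul (by positivity)]

theorem sum_mul_tsum {ι : Type*} (s : Finset ι) (c : ℝ≥0∞) (a b : ℕ → ℝ≥0∞)
    (f : ι → ℕ → ℝ≥0∞) : ∑ i ∈ s, c * ∑' j, a j * (b j * f i j)
      = c * ∑' j, a j * (b j * ∑ i ∈ s, f i j) := by
  rw [← Finset.mul_sum, ← Summable.tsum_finsetSum fun _ _ => ENNReal.summable]
  simp only [Finset.mul_sum]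

/-! ### Reformulation of the two energies -/

/-- The sum of the squared differences over pairs of vertices of a cell. -/
def vertexSum (u : Plane → ℝ) {n : ℕ} (w : Fin n → Fin 3) : ℝ≥0∞ :=
  ∑ i, ∑ j, sq (u (wordMap w (corner i)) - u (wordMap w (corner j)))

/-- The sum of `vertexSum` over all words of length `n`. -/
def vertexSumLevel (u : Plane → ℝ) (n : ℕ) : ℝ≥0∞ := ∑ w : Fin n → Fin 3, vertexSum u w

/-- The double integral of the squared difference over a cell. -/
def pairIntegral (u : Plane → ℝ) {n : ℕ} (w : Fin n → Fin 3) : ℝ≥0∞ :=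
  ∫⁻ x in cell w, ∫⁻ y in cell w, sq (u x - u y) ∂nu ∂nu

/-- The sum of `pairIntegral` over all words of length `n`. -/
def pairIntegralLevel (u : Plane → ℝ) (n : ℕ) : ℝ≥0∞ := ∑ w : Fin n → Fin 3, pairIntegral u w

/-- A cell has three distinct vertices, so the sum over its vertex set is a sum over corner indices.
-/
theorem ofReal_levelSum (u : Plane → ℝ) (n : ℕ) :
    ENNReal.ofReal (levelSum n u) = vertexSumLevel u n := by
  classical
  have h (w : Fin n → Fin 3) (f : Plane → ℝ) :
      ∑ p ∈ cellVertices w, f p = ∑ i, f (wordMap w (corner i)) := by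
    rw [cellVertices, Finset.sum_image (wordMap_injective w).injOn,
      Finset.sum_image corner_injective.injOn]
  simp only [levelSum, h, vertexSumLevel, vertexSum, sq]
  rw [ENNReal.ofReal_sum_of_nonneg fun w _ => by positivity]
  refine Finset.sum_congr rfl fun w _ => ?_
  rw [ENNReal.ofReal_sum_of_nonneg fun w _ => by positivity]
  refine Finset.sum_congr rfl fun i _ => ?_
  rw [ENNReal.ofReal_sum_of_nonneg fun w _ => by positivity]

theorem two_rpow_sub_alpha (β : ℝ) : (2 : ℝ) ^ (β - alpha) = 2 ^ β / 3 := by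
  rw [Real.rpow_sub (by norm_num), two_rpow_alpha]

theorem two_rpow_alpha_add (β : ℝ) : (2 : ℝ) ^ (alpha + β) = 3 * 2 ^ β := by
  rw [Real.rpow_add (by norm_num), two_rpow_alpha]

theorem discreteEnergy_eq (β : ℝ) (u : Plane → ℝ) :
    discreteEnergy β u =
      ∑' n : ℕ, ENNReal.ofReal ((2 : ℝ) ^ β / 3) ^ (n + 1) * vertexSumLevel u (n + 1) := by
  refine tsum_congr fun n => ?_
  rw [Real.rpow_mul (by norm_num), Real.rpow_natCast, ENNReal.ofReal_mul (by positivity),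
    ofReal_levelSum, two_rpow_sub_alpha, ENNReal.ofReal_pow (by positivity)]

/-- Over the product measure the estimates become pointwise in the pair of points. The value of the
kernel on the diagonal is immaterial, as the squared difference vanishes there. -/
theorem integralEnergy_eq (β : ℝ) {u : Plane → ℝ} (hu : Continuous u) :
    integralEnergy β u = ∫⁻ z, sq (u z.1 - u z.2)
      * ENNReal.ofReal ((dist z.1 z.2 ^ (alpha + β))⁻¹) ∂(nu.prod nu) := by
  rw [lintegral_prod_symm']
  · refine lintegral_congr fun y => lintegral_congr fun x => ?_
    rw [div_eq_mul_inv, ENNReal.ofReal_mul (by positivity), sq]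
  · refine (measurable_sq_sub (hu.measurable.comp measurable_fst)
      (hu.measurable.comp measurable_snd)).mul ?_
    have : Measurable fun z : Plane × Plane => dist z.1 z.2 := continuous_dist.measurable
    fun_prop

theorem setLIntegral_prod_cell {u : Plane → ℝ} (hu : Continuous u) {n : ℕ}
    (w v : Fin n → Fin 3) :
    ∫⁻ z in cell w ×ˢ cell v, sq (u z.1 - u z.2) ∂(nu.prod nu)
      = ∫⁻ x in cell w, ∫⁻ y in cell v, sq (u x - u y) ∂nu ∂nu := by
  rw [← Measure.prod_restrict, lintegral_prod]
  exact (measurable_sq_sub (hu.measurable.comp measurable_fst)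
      (hu.measurable.comp measurable_snd)).aemeasurable

theorem discreteEnergy_congr (β : ℝ) {u v : Plane → ℝ} (h : Set.EqOn u v gasket) :
    discreteEnergy β u = discreteEnergy β v := by
  have hc {n : ℕ} (w : Fin n → Fin 3) (i : Fin 3) :
      u (wordMap w (corner i)) = v (wordMap w (corner i)) :=
    h (wordMap_mem_gasket w (corner_mem_gasket i))
  simp only [discreteEnergy_eq, vertexSumLevel, vertexSum, hc]

theorem integralEnergy_congr (β : ℝ) {u v : Plane → ℝ} (h : Set.EqOn u v gasket) :
    integralEnergy β u = integralEnergy β v := by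
  refine lintegral_congr_ae ?_
  filter_upwards [ae_mem_gasket] with y hy
  refine lintegral_congr_ae ?_
  filter_upwards [ae_mem_gasket] with x hx
  rw [h hx, h hy]

/-! ### Concatenated words and convergence along an address -/

theorem append_injective {n j : ℕ} (v : Fin j → Fin 3) :
    Function.Injective fun w : Fin n → Fin 3 => Fin.append w v := fun w w' h =>
  congrArg Prod.fst ((Fin.appendEquiv n j).injective (a₁ := (w, v)) (a₂ := (w', v)) h)

theorem sum_append {n j : ℕ} (f : (Fin (n + j) → Fin 3) → ℝ≥0∞) :
    ∑ w : Fin n → Fin 3, ∑ v : Fin j → Fin 3, f (Fin.append w v) = ∑ w, f w := by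
  rw [← Fintype.sum_prod_type']
  exact (Fin.appendEquiv n j).sum_comp f

theorem append_prefix_succ {n : ℕ} (w : Fin n → Fin 3) (ω : ℕ → Fin 3) (j : ℕ) :
    Fin.append w (fun k : Fin (j + 1) => ω k)
      = (Fin.snoc (Fin.append w fun k : Fin j => ω k) (ω j) : Fin (n + j + 1) → Fin 3) := by
  have h : (fun k : Fin (j + 1) => ω k)
      = (Fin.snoc (fun k : Fin j => ω k) (ω j) : Fin (j + 1) → Fin 3) := by
    ext k
    refine Fin.lastCases ?_ (fun k => ?_) k <;> simp
  rw [h]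
  exact Fin.append_snoc w (fun k : Fin j => ω k) (ω j)

theorem append_prefix_zero {n : ℕ} (w : Fin n → Fin 3) (ω : ℕ → Fin 3) :
    Fin.append w (fun k : Fin 0 => ω k) = w := by
  rw [Subsingleton.elim (fun k : Fin 0 => ω k) Fin.elim0, Fin.append_elim0]
  rfl

theorem wordMap_code_mem_cell {n : ℕ} (w : Fin n → Fin 3) (ω : ℕ → Fin 3) (j : ℕ) :
    wordMap w (code ω) ∈ cell (Fin.append w fun k : Fin j => ω k) := by
  rw [code_eq_wordMap j, ← wordMap_append]
  exact ⟨_, code_mem_gasket _, rfl⟩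

theorem tendsto_of_mem_cell {n : ℕ} (w : Fin n → Fin 3) (ω : ℕ → Fin 3) {c : ℕ → Plane}
    (hc : ∀ j, c j ∈ cell (Fin.append w fun k : Fin j => ω k)) :
    Filter.Tendsto c Filter.atTop (nhds (wordMap w (code ω))) := by
  refine tendsto_iff_dist_tendsto_zero.2 (squeeze_zero (fun _ => dist_nonneg)
    (fun j => dist_le_of_mem_cell (hc j) (wordMap_code_mem_cell w ω j)) ?_)
  have h : Filter.Tendsto (fun j : ℕ => ((2 : ℝ)⁻¹ ^ (n + j)) * diameter) Filter.atTop
      (nhds (0 * diameter)) := by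
    refine Filter.Tendsto.mul_const _ ?_
    simp only [pow_add]
    simpa only [mul_zero] using (tendsto_pow_atTop_nhds_zero_of_lt_one (r := (2⁻¹ : ℝ)) (by norm_num)
      (by norm_num)).const_mul ((2 : ℝ)⁻¹ ^ n)
  simpa [inv_pow] using h

/-! ### The discrete energy is bounded by the integral energy -/

/-- Some point does no worse than the average, and 3^n is the reciprocal mass of the cell. These
points are the representatives through which vertices are reached. -/
theorem exists_mem_cell_lintegral_le {u : Plane → ℝ} (hu : Continuous u) {n : ℕ}
    (w : Fin n → Fin 3) :
    ∃ x ∈ cell w, ∫⁻ y in cell w, sq (u x - u y) ∂nu ≤ 3 ^ n * pairIntegral u w := by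
  have hm : Measurable fun x => ∫⁻ y in cell w, sq (u x - u y) ∂nu :=
    Measurable.lintegral_prod_right (measurable_sq_sub (hu.measurable.comp measurable_fst)
      (hu.measurable.comp measurable_snd))
  obtain ⟨x, hx, h⟩ := exists_le_setLAverage (μ := nu) (s := cell w) (by rw [nu_cell]; simp)
    (measure_ne_top _ _) hm.aemeasurable
  refine ⟨x, hx, h.trans (le_of_eq ?_)⟩
  rw [setLAverage_eq, nu_cell, div_eq_mul_inv, inv_inv, mul_comm]
  rfl

theorem pairIntegral_mono (u : Plane → ℝ) {n m : ℕ} {w : Fin n → Fin 3} {v : Fin m → Fin 3}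
    (h : cell w ⊆ cell v) : pairIntegral u w ≤ pairIntegral u v :=
  (lintegral_mono fun _ => lintegral_mono_set h).trans (lintegral_mono_set h)

/-- Insert u(y) and integrate over y in the subcell, of mass 3^(-(n+1)): the constant is 3^(n+1) · 8
· 3^n = 24 · 9^n. -/
theorem sq_sub_le_pairIntegral {u : Plane → ℝ} (hu : Continuous u) {n : ℕ} {w : Fin n → Fin 3}
    {i : Fin 3} {x x' : Plane}
    (hx : ∫⁻ y in cell w, sq (u x - u y) ∂nu ≤ 3 ^ n * pairIntegral u w)
    (hx' : ∫⁻ y in cell (Fin.snoc w i : Fin (n + 1) → Fin 3), sq (u x' - u y) ∂nu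
      ≤ 3 ^ (n + 1) * pairIntegral u (Fin.snoc w i : Fin (n + 1) → Fin 3)) :
    sq (u x' - u x) ≤ 24 * 9 ^ n * pairIntegral u w := by
  have hsub := cell_snoc_subset w i
  have h1 : (3 ^ (n + 1))⁻¹ * sq (u x' - u x) ≤ 8 * 3 ^ n * pairIntegral u w := by
    calc (3 ^ (n + 1))⁻¹ * sq (u x' - u x)
        = ∫⁻ _y in cell (Fin.snoc w i : Fin (n + 1) → Fin 3), sq (u x' - u x) ∂nu := by
          rw [setLIntegral_const, nu_cell, mul_comm]
      _ ≤ ∫⁻ y in cell (Fin.snoc w i : Fin (n + 1) → Fin 3),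
            2 * (sq (u x' - u y) + sq (u x - u y)) ∂nu := by
          refine lintegral_mono fun y => ?_
          rw [sq_sub_comm (u x)]
          exact sq_sub_le _ _ _
      _ = 2 * (∫⁻ y in cell (Fin.snoc w i : Fin (n + 1) → Fin 3), sq (u x' - u y) ∂nu
            + ∫⁻ y in cell (Fin.snoc w i : Fin (n + 1) → Fin 3), sq (u x - u y) ∂nu) := by
          rw [lintegral_const_mul' _ _ (by norm_num),
            lintegral_add_left (measurable_sq_sub measurable_const hu.measurable)]
      _ ≤ 2 * (3 ^ (n + 1) * pairIntegral u w + 3 ^ n * pairIntegral u w) := by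
          gcongr
          · exact hx'.trans (mul_le_mul_right (pairIntegral_mono u hsub) _)
          · exact (lintegral_mono_set hsub).trans hx
      _ = 8 * 3 ^ n * pairIntegral u w := by rw [pow_succ]; ring
  rw [ENNReal.inv_mul_le_iff (by simp) (by finiteness)] at h1
  refine h1.trans (le_of_eq ?_)
  have : (9 : ℝ≥0∞) ^ n = 3 ^ n * 3 ^ n := by rw [← mul_pow]; norm_num
  rw [this]
  ring

/-- Telescope from each vertex to the representative of its cell through the representatives of w,
wi, wii, …. The constant is 864 = 12 · 3 · 24: 12 from replacing vertex pairs by differences to the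
representative, 3 corners, 24 per step. -/
theorem vertexSumLevel_le {u : Plane → ℝ} (hu : Continuous u) {μ : ℝ} (hμ : 1 < μ) (n : ℕ) :
    vertexSumLevel u n ≤ 864 * ENNReal.ofReal ((1 - μ⁻¹)⁻¹) *
      ∑' j, ENNReal.ofReal μ ^ j * (9 ^ (n + j) * pairIntegralLevel u (n + j)) := by
  choose X hX hXle using fun (m : ℕ) (w : Fin m → Fin 3) => exists_mem_cell_lintegral_le hu w
  have h1 (w : Fin n → Fin 3) (i : Fin 3) : sq (u (wordMap w (corner i)) - u (X n w))
      ≤ ENNReal.ofReal ((1 - μ⁻¹)⁻¹) * ∑' j, ENNReal.ofReal μ ^ j *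
        (24 * 9 ^ (n + j) * pairIntegral u (Fin.append w fun _ : Fin j => i)) := by
    have ht := (hu.tendsto _).comp (tendsto_of_mem_cell w (fun _ => i)
      fun j => hX _ (Fin.append w fun _ : Fin j => i))
    have h2 := sq_sub_le_tsum_of_tendsto hμ ht
    have h0 := append_prefix_zero w fun _ => i
    simp only [Function.comp_apply, code_const] at h2
    have h00 : X (n + 0) (Fin.append w fun _ : Fin 0 => i) = X n w := congrArg (X n) h0
    rw [h00] at h2
    refine h2.trans ?_
    gcongr with j
    refine sq_sub_le_pairIntegral hu (i := i) (hXle _ _) ?_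
    have hs := append_prefix_succ w (fun _ => i) j
    rw [← hs]
    exact hXle _ _
  have h2 (w : Fin n → Fin 3) :
      vertexSum u w ≤ 12 * ∑ i, sq (u (wordMap w (corner i)) - u (X n w)) := by
    calc vertexSum u w ≤ ∑ i, ∑ j, 2 * (sq (u (wordMap w (corner i)) - u (X n w))
          + sq (u (wordMap w (corner j)) - u (X n w))) := by
          refine Finset.sum_le_sum fun i _ => Finset.sum_le_sum fun j _ => ?_
          rw [sq_sub_comm (u (wordMap w (corner j)))]
          exact sq_sub_le _ _ _
      _ = _ := by
          simp only [Fin.sum_univ_three]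
          ring
  -- For fixed i and j, distinct w give distinct words w i^j, so no cell of level n + j is counted
  -- twice.
  have h3 (i : Fin 3) (j : ℕ) : ∑ w : Fin n → Fin 3,
      pairIntegral u (Fin.append w fun _ : Fin j => i) ≤ pairIntegralLevel u (n + j) := by
    classical
    rw [← Finset.sum_image (f := fun v : Fin (n + j) → Fin 3 => pairIntegral u v)
      (append_injective fun _ : Fin j => i).injOn]
    exact Finset.sum_le_sum_of_subset (Finset.subset_univ _)
  calc vertexSumLevel u n
      ≤ ∑ w : Fin n → Fin 3, 12 * ∑ i, sq (u (wordMap w (corner i)) - u (X n w)) :=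
        Finset.sum_le_sum fun w _ => h2 w
    _ = 12 * ∑ i, ∑ w : Fin n → Fin 3, sq (u (wordMap w (corner i)) - u (X n w)) := by
        rw [← Finset.mul_sum, Finset.sum_comm]
    _ ≤ 12 * ∑ i, ∑ w : Fin n → Fin 3, ENNReal.ofReal ((1 - μ⁻¹)⁻¹) * ∑' j,
        ENNReal.ofReal μ ^ j *
          (24 * 9 ^ (n + j) * pairIntegral u (Fin.append w fun _ : Fin j => i)) := by
        gcongr with i _ w
        exact h1 w i
    _ = 12 * ∑ i : Fin 3, ENNReal.ofReal ((1 - μ⁻¹)⁻¹) * ∑' j, ENNReal.ofReal μ ^ j *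
          (24 * 9 ^ (n + j) * ∑ w : Fin n → Fin 3,
            pairIntegral u (Fin.append w fun _ : Fin j => i)) := by
        congr 1
        exact Finset.sum_congr rfl fun i _ => sum_mul_tsum _ _ _ _ _
    _ ≤ 12 * ∑ _i : Fin 3, ENNReal.ofReal ((1 - μ⁻¹)⁻¹) * ∑' j, ENNReal.ofReal μ ^ j *
          (24 * 9 ^ (n + j) * pairIntegralLevel u (n + j)) := by
        gcongr with i _ j
        exact h3 i j
    _ = _ := by
        have (j : ℕ) : ENNReal.ofReal μ ^ j * (24 * 9 ^ (n + j) * pairIntegralLevel u (n + j))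
            = 24 * (ENNReal.ofReal μ ^ j * (9 ^ (n + j) * pairIntegralLevel u (n + j))) := by ring
        simp only [this, ENNReal.tsum_mul_left, Finset.sum_const, Finset.card_univ,
          Fintype.card_fin, nsmul_eq_mul]
        push_cast
        ring

/-- All level-m cells containing a given point are mutually adjacent, so a pair of points shares at
most 27 of them, and none unless 2^m |x - y| ≤ diam K. Summing over m under the integral produces
the kernel. -/
theorem tsum_pairIntegralLevel_le {β : ℝ} (hβ : 0 < alpha + β) {u : Plane → ℝ}
    (hu : Continuous u) :
    ∑' m, ENNReal.ofReal ((2 : ℝ) ^ (alpha + β)) ^ m * pairIntegralLevel u m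
      ≤ 27 * ENNReal.ofReal ((2 : ℝ) ^ (alpha + β) / (2 ^ (alpha + β) - 1)
        * diameter ^ (alpha + β)) * integralEnergy β u := by
  classical
  set Q := ENNReal.ofReal ((2 : ℝ) ^ (alpha + β)) with hQ
  have hms : Measurable fun z : Plane × Plane => sq (u z.1 - u z.2) :=
    measurable_sq_sub (hu.measurable.comp measurable_fst) (hu.measurable.comp measurable_snd)
  have h1 (m : ℕ) : pairIntegralLevel u m = ∫⁻ z, ∑ w : Fin m → Fin 3,
      (cell w ×ˢ cell w).indicator (fun z => sq (u z.1 - u z.2)) z ∂(nu.prod nu) := by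
    rw [lintegral_finsetSum _ fun w _ => hms.indicator ((measurableSet_cell w).prod
      (measurableSet_cell w))]
    refine Finset.sum_congr rfl fun w _ => ?_
    rw [lintegral_indicator ((measurableSet_cell w).prod (measurableSet_cell w)),
      setLIntegral_prod_cell hu, pairIntegral]
  have h2 (m : ℕ) (z : Plane × Plane) : ∑ w : Fin m → Fin 3,
      (cell w ×ˢ cell w).indicator (fun z => sq (u z.1 - u z.2)) z
      ≤ 27 * (if 2 ^ m * dist z.1 z.2 ≤ diameter then 1 else 0) * sq (u z.1 - u z.2) := by
    by_cases hz : ∃ w : Fin m → Fin 3, z ∈ cell w ×ˢ cell w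
    · obtain ⟨w₀, hw₀⟩ := hz
      have hd : 2 ^ m * dist z.1 z.2 ≤ diameter := by
        have := dist_le_of_mem_cell hw₀.1 hw₀.2
        rwa [le_inv_mul_iff₀ (by positivity)] at this
      rw [if_pos hd, mul_one]
      calc _ = ∑ w ∈ Finset.univ.filter fun w => Adjacent w w₀,
            (cell w ×ˢ cell w).indicator (fun z => sq (u z.1 - u z.2)) z := by
            refine (Finset.sum_subset (Finset.subset_univ _) fun w _ hw => ?_).symm
            refine Set.indicator_of_notMem (fun hzw => hw ?_) _
            exact Finset.mem_filter.2 ⟨Finset.mem_univ _, adjacent_of_mem_cell hzw.1 hw₀.1⟩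
        _ ≤ ∑ w ∈ Finset.univ.filter fun w => Adjacent w w₀, sq (u z.1 - u z.2) :=
            Finset.sum_le_sum fun w _ => Set.indicator_le_self _ _ _
        _ ≤ 27 * sq (u z.1 - u z.2) := by
            rw [Finset.sum_const, nsmul_eq_mul]
            gcongr
            exact_mod_cast card_adjacent_le w₀
    · push Not at hz
      rw [Finset.sum_eq_zero fun w _ => Set.indicator_of_notMem (hz w) _]
      exact zero_le
  have hm (m : ℕ) : Measurable fun z : Plane × Plane => Q ^ m * ∑ w : Fin m → Fin 3,
      (cell w ×ˢ cell w).indicator (fun z => sq (u z.1 - u z.2)) z :=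
    (Finset.measurable_sum _ fun w _ => hms.indicator ((measurableSet_cell w).prod
      (measurableSet_cell w))).const_mul _
  rw [integralEnergy_eq β hu, ← lintegral_const_mul' _ _ (by finiteness)]
  have h3 (m : ℕ) : Q ^ m ≠ ∞ := by finiteness
  simp only [h1, ← lintegral_const_mul' _ _ (h3 _)]
  rw [← lintegral_tsum fun m => (hm m).aemeasurable]
  refine lintegral_mono fun z => ?_
  rcases eq_or_ne z.1 z.2 with hz | hz
  · have h0 : sq (u z.1 - u z.2) = 0 := by simp [sq, hz]
    have : ∀ m, Q ^ m * ∑ w : Fin m → Fin 3,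
      (cell w ×ˢ cell w).indicator (fun z => sq (u z.1 - u z.2)) z = 0 := fun m => by
        refine mul_eq_zero_of_right _ (le_antisymm ((h2 m z).trans ?_) zero_le)
        rw [h0, mul_zero]
    simp only [this, tsum_zero]
    exact zero_le
  calc _ ≤ ∑' m, 27 * sq (u z.1 - u z.2) *
        (if 2 ^ m * dist z.1 z.2 ≤ diameter then Q ^ m else 0) := by
        refine ENNReal.tsum_le_tsum fun m => (mul_le_mul_right (h2 m z) _).trans (le_of_eq ?_)
        split_ifs <;> ring
    _ ≤ 27 * sq (u z.1 - u z.2) * (ENNReal.ofReal ((2 : ℝ) ^ (alpha + β) / (2 ^ (alpha + β) - 1)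
        * diameter ^ (alpha + β)) * ENNReal.ofReal ((dist z.1 z.2 ^ (alpha + β))⁻¹)) := by
        rw [ENNReal.tsum_mul_left]
        gcongr
        exact tsum_ite_pow_le hβ diameter_nonneg (dist_pos.2 hz)
    _ = _ := by ring

theorem ofReal_div_three_mul_nine (β : ℝ) : 9 * ENNReal.ofReal ((2 : ℝ) ^ β / 3)
    = ENNReal.ofReal ((2 : ℝ) ^ (alpha + β)) := by
  have h9 : (9 : ℝ≥0∞) = ENNReal.ofReal 9 := by norm_num
  rw [h9, ← ENNReal.ofReal_mul (by norm_num), two_rpow_alpha_add]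
  congr 1
  ring

theorem three_lt_two_rpow {β : ℝ} (hβ : alpha < β) : (3 : ℝ) < 2 ^ β := by
  rw [← two_rpow_alpha]
  exact Real.rpow_lt_rpow_of_exponent_lt one_lt_two hβ

theorem exists_discreteEnergy_le {β : ℝ} (hβ : alpha < β) :
    ∃ C : ℝ≥0∞, C ≠ ∞ ∧ ∀ u : Plane → ℝ, Continuous u →
      discreteEnergy β u ≤ C * integralEnergy β u := by
  have hB := three_lt_two_rpow hβ
  -- The midpoint of 1 and 2^β/3: any μ strictly between would do, and such a μ exists because β >
  -- α.
  set μ : ℝ := ((2 : ℝ) ^ β / 3 + 1) / 2 with hμdef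
  set R := ENNReal.ofReal ((2 : ℝ) ^ β / 3) with hR
  have hμ : 1 < μ := by linarith
  have hμR : μ < (2 : ℝ) ^ β / 3 := by linarith
  set ρ : ℝ≥0∞ := ENNReal.ofReal (μ / ((2 : ℝ) ^ β / 3)) with hρ
  have hρ1 : ρ < 1 := ENNReal.ofReal_lt_one.2 ((div_lt_one (by positivity)).2 hμR)
  have hρR : ENNReal.ofReal μ = ρ * R := by
    rw [← ENNReal.ofReal_mul (by positivity), div_mul_cancel₀ _ (by positivity)]
  refine ⟨864 * ENNReal.ofReal ((1 - μ⁻¹)⁻¹) * ((1 - ρ)⁻¹ *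
    (27 * ENNReal.ofReal ((2 : ℝ) ^ (alpha + β) / (2 ^ (alpha + β) - 1)
        * diameter ^ (alpha + β)))), ?_, fun u hu => ?_⟩
  · have : (1 - ρ)⁻¹ ≠ ∞ := ENNReal.inv_ne_top.2 (tsub_pos_of_lt hρ1).ne'
    finiteness
  have hγ : 0 < alpha + β := by linarith [alpha_pos]
  calc discreteEnergy β u = ∑' n, R ^ (n + 1) * vertexSumLevel u (n + 1) := discreteEnergy_eq β u
    _ ≤ ∑' n, R ^ n * vertexSumLevel u n :=
        ENNReal.tsum_comp_le_tsum_of_injective (add_left_injective 1)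
          fun n => R ^ n * vertexSumLevel u n
    _ ≤ ∑' n, R ^ n * (864 * ENNReal.ofReal ((1 - μ⁻¹)⁻¹) *
          ∑' j, ENNReal.ofReal μ ^ j * (9 ^ (n + j) * pairIntegralLevel u (n + j))) := by
        gcongr with n
        exact vertexSumLevel_le hu hμ n
    _ = 864 * ENNReal.ofReal ((1 - μ⁻¹)⁻¹) *
          ∑' n, ∑' j, ρ ^ j * ((9 * R) ^ (n + j) * pairIntegralLevel u (n + j)) := by
        rw [← ENNReal.tsum_mul_left]
        refine tsum_congr fun n => ?_
        rw [mul_left_comm, ← ENNReal.tsum_mul_left]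
        congr 1
        refine tsum_congr fun j => ?_
        rw [hρR, mul_pow, mul_pow, pow_add R]
        ring
    _ ≤ 864 * ENNReal.ofReal ((1 - μ⁻¹)⁻¹) *
          ((1 - ρ)⁻¹ * ∑' m, (9 * R) ^ m * pairIntegralLevel u m) := by
        gcongr
        exact tsum_tsum_pow_mul_le ρ fun m => (9 * R) ^ m * pairIntegralLevel u m
    _ ≤ _ := by
        rw [ofReal_div_three_mul_nine]
        refine (mul_le_mul_right (mul_le_mul_right (tsum_pairIntegralLevel_le hγ hu) _) _).trans
          (le_of_eq ?_)
        ring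

/-! ### The integral energy is bounded by the discrete energy -/

theorem sq_sub_le_vertexSum (u : Plane → ℝ) {n : ℕ} (w : Fin n → Fin 3) (i j : Fin 3) :
    sq (u (wordMap w (corner i)) - u (wordMap w (corner j))) ≤ vertexSum u w :=
  (Finset.single_le_sum_of_canonicallyOrdered (f := fun j =>
    sq (u (wordMap w (corner i)) - u (wordMap w (corner j)))) (Finset.mem_univ j)).trans
  (Finset.single_le_sum_of_canonicallyOrdered (f := fun i => ∑ j,
    sq (u (wordMap w (corner i)) - u (wordMap w (corner j)))) (Finset.mem_univ i))

/-- The telescoping sequence consists of vertices of the cells along the address. Since `corner (ω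
j)` is fixed by its own contraction, the vertex chosen at step j + 1 is already a vertex of the cell
of step j, so each increment is bounded by one `vertexSum`. -/
theorem sq_sub_code_le_tsum {u : Plane → ℝ} (hu : Continuous u) {μ : ℝ} (hμ : 1 < μ) {n : ℕ}
    (w : Fin n → Fin 3) (i : Fin 3) (ω : ℕ → Fin 3) :
    sq (u (wordMap w (code ω)) - u (wordMap w (corner i))) ≤ ENNReal.ofReal ((1 - μ⁻¹)⁻¹) *
      ∑' j, ENNReal.ofReal μ ^ j * vertexSum u (Fin.append w fun k : Fin j => ω k) := by
  -- The address shifted by one place with i in front, so that the sequence starts at the prescribed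
  -- corner.
  let η : ℕ → Fin 3 := fun j => Nat.casesOn j i ω
  let c : ℕ → Plane := fun j => wordMap (Fin.append w fun k : Fin j => ω k) (corner (η (j + 1)))
  let b : ℕ → Plane := fun j => wordMap (Fin.append w fun k : Fin j => ω k) (corner (η j))
  have hbc (j : ℕ) : b (j + 1) = c j := by
    have h := congrArg (fun v : Fin (n + j + 1) → Fin 3 => wordMap v (corner (ω j)))
      (append_prefix_succ w ω j)
    refine Eq.trans h ?_
    simp only [wordMap_snoc, contraction_corner]
    rfl
  have hb : Filter.Tendsto b Filter.atTop (nhds (wordMap w (code ω))) :=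
    tendsto_of_mem_cell w ω fun j => wordMap_corner_mem_cell _ _
  have h := sq_sub_le_tsum_of_tendsto hμ ((hu.tendsto _).comp hb)
  have hb0 : b 0 = wordMap w (corner i) :=
    congrArg (fun v : Fin n → Fin 3 => wordMap v (corner i)) (append_prefix_zero w ω)
  simp only [Function.comp_apply, hb0, hbc] at h
  refine h.trans ?_
  gcongr with j
  exact sq_sub_le_vertexSum u _ _ _

/-- Summing over all subcells containing x removes the choice of an address and leaves a bound
measurable in x. -/
theorem sq_sub_le_tsum_indicator {u : Plane → ℝ} (hu : Continuous u) {μ : ℝ} (hμ : 1 < μ) {n : ℕ}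
    (w : Fin n → Fin 3) (i : Fin 3) {x : Plane} (hx : x ∈ cell w) :
    sq (u x - u (wordMap w (corner i))) ≤ ENNReal.ofReal ((1 - μ⁻¹)⁻¹) *
      ∑' j, ENNReal.ofReal μ ^ j * ∑ v : Fin j → Fin 3,
        (cell (Fin.append w v)).indicator (fun _ => vertexSum u (Fin.append w v)) x := by
  obtain ⟨y, hy, rfl⟩ := hx
  rw [← range_code] at hy
  obtain ⟨ω, rfl⟩ := hy
  refine (sq_sub_code_le_tsum hu hμ w i ω).trans ?_
  gcongr with j
  refine le_trans (le_of_eq ?_) (Finset.single_le_sum_of_canonicallyOrdered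
    (f := fun v : Fin j → Fin 3 => (cell (Fin.append w v)).indicator
      (fun _ => vertexSum u (Fin.append w v)) (wordMap w (code ω)))
    (Finset.mem_univ (fun k : Fin j => ω k)))
  exact (Set.indicator_of_mem (wordMap_code_mem_cell w ω j)
    (fun _ => vertexSum u (Fin.append w fun k : Fin j => ω k))).symm

/-- The sum over the corners of a cell of the mean square distance to the value there. -/
def cornerIntegral (u : Plane → ℝ) {n : ℕ} (w : Fin n → Fin 3) : ℝ≥0∞ :=
  ∑ i, ∫⁻ x in cell w, sq (u x - u (wordMap w (corner i))) ∂nu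

theorem cornerIntegral_le {u : Plane → ℝ} (hu : Continuous u) {μ : ℝ} (hμ : 1 < μ) {n : ℕ}
    (w : Fin n → Fin 3) :
    cornerIntegral u w ≤ 3 * ENNReal.ofReal ((1 - μ⁻¹)⁻¹) *
      ∑' j, ENNReal.ofReal μ ^ j * ((3 ^ (n + j))⁻¹ *
        ∑ v : Fin j → Fin 3, vertexSum u (Fin.append w v)) := by
  have hmi {j : ℕ} (v : Fin j → Fin 3) : Measurable fun x =>
      (cell (Fin.append w v)).indicator (fun _ => vertexSum u (Fin.append w v)) x :=
    measurable_const.indicator (measurableSet_cell _)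
  have hms (j : ℕ) : Measurable fun x => ∑ v : Fin j → Fin 3,
      (cell (Fin.append w v)).indicator (fun _ => vertexSum u (Fin.append w v)) x :=
    Finset.measurable_sum _ fun v _ => hmi v
  have h (i : Fin 3) : ∫⁻ x in cell w, sq (u x - u (wordMap w (corner i))) ∂nu
      ≤ ENNReal.ofReal ((1 - μ⁻¹)⁻¹) * ∑' j, ENNReal.ofReal μ ^ j * ((3 ^ (n + j))⁻¹ *
        ∑ v : Fin j → Fin 3, vertexSum u (Fin.append w v)) := by
    refine (setLIntegral_mono' (measurableSet_cell w) fun x hx =>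
      sq_sub_le_tsum_indicator hu hμ w i hx).trans ?_
    rw [lintegral_const_mul' _ _ (by finiteness),
      lintegral_tsum fun j => ((hms j).const_mul _).aemeasurable]
    gcongr with j
    rw [lintegral_const_mul _ (hms j), lintegral_finsetSum _ fun v _ => hmi v]
    refine mul_le_mul_right (le_trans (Finset.sum_le_sum fun v _ => ?_)
      (Finset.mul_sum _ _ _).ge) _
    refine (setLIntegral_le_lintegral _ _).trans (le_of_eq ?_)
    rw [lintegral_indicator (measurableSet_cell _), setLIntegral_const, nu_cell, mul_comm]
  refine (Finset.sum_le_sum fun i _ => h i).trans (le_of_eq ?_)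
  simp only [Finset.sum_const, Finset.card_univ, Fintype.card_fin, nsmul_eq_mul]
  push_cast
  ring

theorem sum_cornerIntegral_le {u : Plane → ℝ} (hu : Continuous u) {μ : ℝ} (hμ : 1 < μ) (n : ℕ) :
    ∑ w : Fin n → Fin 3, cornerIntegral u w ≤ 3 * ENNReal.ofReal ((1 - μ⁻¹)⁻¹) *
      ∑' j, ENNReal.ofReal μ ^ j * ((3 ^ (n + j))⁻¹ * vertexSumLevel u (n + j)) := by
  refine (Finset.sum_le_sum fun w _ => cornerIntegral_le hu hμ w).trans (le_of_eq ?_)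
  rw [sum_mul_tsum Finset.univ _ _ _
    fun (w : Fin n → Fin 3) j => ∑ v : Fin j → Fin 3, vertexSum u (Fin.append w v)]
  simp only [sum_append fun w => vertexSum u w, vertexSumLevel]

/-- Compare both values of u with the value at a shared vertex; the variable that drops out
contributes the mass 3^(-n). -/
theorem Adjacent.lintegral_le {u : Plane → ℝ} (hu : Continuous u) {n : ℕ} {w v : Fin n → Fin 3}
    (h : Adjacent w v) : ∫⁻ x in cell w, ∫⁻ y in cell v, sq (u x - u y) ∂nu ∂nu
      ≤ 2 * (3 ^ n)⁻¹ * (cornerIntegral u w + cornerIntegral u v) := by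
  obtain ⟨i, j, hij⟩ := h.exists_wordMap_corner_eq
  set p := wordMap w (corner i) with hp
  have hm : Measurable fun x => sq (u x - u p) := measurable_sq_sub hu.measurable measurable_const
  calc _ ≤ ∫⁻ x in cell w, ∫⁻ y in cell v, 2 * (sq (u x - u p) + sq (u y - u p)) ∂nu ∂nu := by
        refine lintegral_mono fun x => lintegral_mono fun y => ?_
        rw [sq_sub_comm (u y)]
        exact sq_sub_le _ _ _
    _ = 2 * (3 ^ n)⁻¹ * (∫⁻ x in cell w, sq (u x - u p) ∂nu
          + ∫⁻ y in cell v, sq (u y - u p) ∂nu) := by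
        have h2 : (2 : ℝ≥0∞) ≠ ∞ := by norm_num
        have h3 : ((3 : ℝ≥0∞) ^ n)⁻¹ ≠ ∞ := by simp
        simp only [lintegral_const_mul' _ _ h2, lintegral_add_left measurable_const,
          setLIntegral_const, nu_cell]
        rw [lintegral_add_left (hm.mul_const _), lintegral_mul_const' _ _ h3, setLIntegral_const,
          nu_cell]
        ring
    _ ≤ _ := by
        gcongr
        · exact Finset.single_le_sum_of_canonicallyOrdered (f := fun i =>
            ∫⁻ x in cell w, sq (u x - u (wordMap w (corner i))) ∂nu) (Finset.mem_univ i)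
        · rw [hij]
          exact Finset.single_le_sum_of_canonicallyOrdered (f := fun i =>
            ∫⁻ x in cell v, sq (u x - u (wordMap v (corner i))) ∂nu) (Finset.mem_univ j)

open Classical in
/-- The double integral of the squared difference over the adjacent pairs of cells. -/
def adjacentIntegral (u : Plane → ℝ) (n : ℕ) : ℝ≥0∞ :=
  ∑ w : Fin n → Fin 3, ∑ v ∈ Finset.univ.filter fun v => Adjacent v w,
    ∫⁻ x in cell w, ∫⁻ y in cell v, sq (u x - u y) ∂nu ∂nu

theorem adjacentIntegral_le {u : Plane → ℝ} (hu : Continuous u) (n : ℕ) :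
    adjacentIntegral u n ≤ 108 * (3 ^ n)⁻¹ * ∑ w : Fin n → Fin 3, cornerIntegral u w := by
  classical
  have h1 : ∑ w : Fin n → Fin 3, ∑ _v ∈ Finset.univ.filter fun v => Adjacent v w,
      cornerIntegral u w ≤ 27 * ∑ w : Fin n → Fin 3, cornerIntegral u w := by
    rw [Finset.mul_sum]
    refine Finset.sum_le_sum fun w _ => ?_
    rw [Finset.sum_const, nsmul_eq_mul]
    gcongr
    exact_mod_cast card_adjacent_le w
  -- Adjacency is symmetric, so both corner terms give the same total.
  have h2 : ∑ w : Fin n → Fin 3, ∑ v ∈ Finset.univ.filter fun v => Adjacent v w,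
      cornerIntegral u v = ∑ w : Fin n → Fin 3, ∑ _v ∈ Finset.univ.filter fun v => Adjacent v w,
      cornerIntegral u w := by
    refine Finset.sum_comm' fun w v => ?_
    simp only [Finset.mem_univ, Finset.mem_filter, true_and, and_true]
    exact ⟨Adjacent.symm, Adjacent.symm⟩
  calc adjacentIntegral u n ≤ ∑ w : Fin n → Fin 3, ∑ v ∈ Finset.univ.filter fun v => Adjacent v w,
        2 * (3 ^ n)⁻¹ * (cornerIntegral u w + cornerIntegral u v) := by
        refine Finset.sum_le_sum fun w _ => Finset.sum_le_sum fun v hv => ?_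
        exact (Finset.mem_filter.1 hv).2.symm.lintegral_le hu
    _ = 4 * (3 ^ n)⁻¹ * ∑ w : Fin n → Fin 3, ∑ _v ∈ Finset.univ.filter fun v => Adjacent v w,
        cornerIntegral u w := by
        simp only [← Finset.mul_sum, Finset.sum_add_distrib, h2]
        ring
    _ ≤ 4 * (3 ^ n)⁻¹ * (27 * ∑ w : Fin n → Fin 3, cornerIntegral u w) := by gcongr
    _ = _ := by ring

/-- Take the least n with 2^(n+2) r ≥ 1; if n > 0, failure at n - 1 reads 2^n r < 1/2, the threshold
for adjacency. -/
theorem exists_nat_scale {r : ℝ} (hr : 0 < r) :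
    ∃ n : ℕ, 1 ≤ 2 ^ (n + 2) * r ∧ (n = 0 ∨ 2 ^ n * r < 2⁻¹) := by
  classical
  have hex : ∃ n : ℕ, 1 ≤ 2 ^ (n + 2) * r := by
    obtain ⟨m, hm⟩ := pow_unbounded_of_one_lt r⁻¹ one_lt_two
    refine ⟨m, ?_⟩
    have h1 := (inv_lt_iff_one_lt_mul₀ hr).1 hm
    have h2 : (2 : ℝ) ^ m ≤ 2 ^ (m + 2) := pow_le_pow_right₀ one_le_two (by omega)
    nlinarith
  refine ⟨Nat.find hex, Nat.find_spec hex, ?_⟩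
  rcases hN : Nat.find hex with _ | M
  · exact Or.inl rfl
  · refine Or.inr ?_
    have := Nat.find_min hex (m := M) (by omega)
    rw [not_le, pow_succ] at this
    linarith

/-- Each pair of distinct points is charged to the single level of `exists_nat_scale`, where its
cells are adjacent and 1/|x - y| ≤ 4 · 2^n. -/
theorem integralEnergy_le_tsum_adjacentIntegral {β : ℝ} (hβ : 0 < alpha + β) {u : Plane → ℝ}
    (hu : Continuous u) :
    integralEnergy β u ≤ ENNReal.ofReal ((4 : ℝ) ^ (alpha + β)) *
      ∑' n, ENNReal.ofReal ((2 : ℝ) ^ (alpha + β)) ^ n * adjacentIntegral u n := by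
  classical
  set Q := ENNReal.ofReal ((2 : ℝ) ^ (alpha + β)) with hQ
  have hms : Measurable fun z : Plane × Plane => sq (u z.1 - u z.2) :=
    measurable_sq_sub (hu.measurable.comp measurable_fst) (hu.measurable.comp measurable_snd)
  have hset {n : ℕ} (w v : Fin n → Fin 3) : MeasurableSet (cell w ×ˢ cell v) :=
    (measurableSet_cell w).prod (measurableSet_cell v)
  let g (n : ℕ) (z : Plane × Plane) : ℝ≥0∞ := ∑ w : Fin n → Fin 3,
    ∑ v ∈ Finset.univ.filter fun v => Adjacent v w,
      (cell w ×ˢ cell v).indicator (fun z => sq (u z.1 - u z.2)) z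
  have hg (n : ℕ) : Measurable (g n) := Finset.measurable_sum _ fun w _ =>
    Finset.measurable_sum _ fun v _ => hms.indicator (hset w v)
  have h1 (n : ℕ) : adjacentIntegral u n = ∫⁻ z, g n z ∂(nu.prod nu) := by
    rw [lintegral_finsetSum _ fun w _ => Finset.measurable_sum _ fun v _ =>
      hms.indicator (hset w v)]
    refine Finset.sum_congr rfl fun w _ => ?_
    rw [lintegral_finsetSum _ fun v _ => hms.indicator (hset w v)]
    refine Finset.sum_congr rfl fun v _ => ?_
    rw [lintegral_indicator (hset w v), setLIntegral_prod_cell hu]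
  have h3 (n : ℕ) : Q ^ n ≠ ∞ := by finiteness
  rw [integralEnergy_eq β hu]
  simp only [h1, ← lintegral_const_mul' _ _ (h3 _)]
  rw [← lintegral_tsum fun n => ((hg n).const_mul _).aemeasurable,
    ← lintegral_const_mul' _ _ (by finiteness)]
  have hae : ∀ᵐ z ∂(nu.prod nu), z.1 ∈ gasket ∧ z.2 ∈ gasket := by
    filter_upwards [Measure.quasiMeasurePreserving_fst.ae ae_mem_gasket,
      Measure.quasiMeasurePreserving_snd.ae ae_mem_gasket] with z h h' using ⟨h, h'⟩
  refine lintegral_mono_ae ?_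
  filter_upwards [hae] with z ⟨hz1, hz2⟩
  rcases eq_or_ne z.1 z.2 with hz | hz
  · have h0 : sq (u z.1 - u z.2) = 0 := by simp [sq, hz]
    rw [h0, zero_mul]
    exact zero_le
  have hr : 0 < dist z.1 z.2 := dist_pos.2 hz
  obtain ⟨n, hn, hn'⟩ := exists_nat_scale hr
  obtain ⟨w, hw⟩ := exists_mem_cell n hz1
  obtain ⟨v, hv⟩ := exists_mem_cell n hz2
  have hwv : Adjacent w v := by
    rcases hn' with rfl | hn'
    -- At level 0 there is only the empty word, so adjacency is automatic however far apart the
    -- points are.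
    · intro i
      simp [index]
    · exact adjacent_of_dist_lt hw hv hn'
  have hk : ENNReal.ofReal ((dist z.1 z.2 ^ (alpha + β))⁻¹)
      ≤ ENNReal.ofReal ((4 : ℝ) ^ (alpha + β)) * Q ^ n := by
    rw [hQ, ← ENNReal.ofReal_pow (by positivity), ← ENNReal.ofReal_mul (by positivity)]
    refine ENNReal.ofReal_le_ofReal ?_
    rw [← Real.inv_rpow hr.le, ← Real.rpow_natCast, ← Real.rpow_mul (by norm_num),
      mul_comm (alpha + β), Real.rpow_mul (by norm_num), Real.rpow_natCast,
      ← Real.mul_rpow (by norm_num) (by positivity)]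
    refine Real.rpow_le_rpow (by positivity) ?_ hβ.le
    rw [inv_le_iff_one_le_mul₀ hr]
    refine hn.trans (le_of_eq ?_)
    ring
  have hs : sq (u z.1 - u z.2) ≤ g n z := by
    refine le_trans ?_ (Finset.single_le_sum_of_canonicallyOrdered (f := fun w : Fin n → Fin 3 =>
      ∑ v ∈ Finset.univ.filter fun v => Adjacent v w,
      (cell w ×ˢ cell v).indicator (fun z => sq (u z.1 - u z.2)) z) (Finset.mem_univ w))
    refine le_trans (le_of_eq ?_) (Finset.single_le_sum_of_canonicallyOrdered
      (f := fun v : Fin n → Fin 3 =>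
      (cell w ×ˢ cell v).indicator (fun z => sq (u z.1 - u z.2)) z)
      (Finset.mem_filter.2 ⟨Finset.mem_univ v, hwv.symm⟩))
    exact (Set.indicator_of_mem (Set.mk_mem_prod hw hv) (fun z : Plane × Plane =>
      sq (u z.1 - u z.2))).symm
  calc _ ≤ g n z * (ENNReal.ofReal ((4 : ℝ) ^ (alpha + β)) * Q ^ n) := mul_le_mul' hs hk
    _ = ENNReal.ofReal ((4 : ℝ) ^ (alpha + β)) * (Q ^ n * g n z) := by ring
    _ ≤ _ := mul_le_mul_right (ENNReal.le_tsum (f := fun n => Q ^ n * g n z) n) _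

theorem contraction_corner_comm (i j : Fin 3) :
    contraction i (corner j) = contraction j (corner i) := by
  rw [contraction, contraction, add_comm]

/-- The discrete energy starts at level 1, but distant pairs of points need level 0. Two corners are
joined through their midpoint, a vertex of both corresponding level-1 cells; 36 is 9 pairs times 4.
-/
theorem vertexSumLevel_zero_le (u : Plane → ℝ) : vertexSumLevel u 0 ≤ 36 * vertexSumLevel u 1 := by
  have h1 (i j k : Fin 3) : sq (u (contraction i (corner j)) - u (contraction i (corner k)))
      ≤ vertexSumLevel u 1 := by
    have h := sq_sub_le_vertexSum u (fun _ : Fin 1 => i) j k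
    exact h.trans (Finset.single_le_sum_of_canonicallyOrdered
      (f := fun w : Fin 1 → Fin 3 => vertexSum u w) (Finset.mem_univ _))
  have h2 (i j : Fin 3) : sq (u (corner i) - u (corner j)) ≤ 4 * vertexSumLevel u 1 := by
    refine (sq_sub_le _ (u (contraction i (corner j))) _).trans ?_
    have e1 := h1 i i j
    have e2 := h1 j i j
    rw [contraction_corner] at e1 e2
    rw [contraction_corner_comm j i] at e2
    calc _ ≤ 2 * (vertexSumLevel u 1 + vertexSumLevel u 1) := by gcongr
      _ = _ := by ring
  calc vertexSumLevel u 0 = ∑ i, ∑ j, sq (u (corner i) - u (corner j)) := by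
        simp [vertexSumLevel, vertexSum, wordMap]
    _ ≤ ∑ _i : Fin 3, ∑ _j : Fin 3, 4 * vertexSumLevel u 1 :=
        Finset.sum_le_sum fun i _ => Finset.sum_le_sum fun j _ => h2 i j
    _ = _ := by
        simp only [Fin.sum_univ_three]
        ring

theorem tsum_vertexSumLevel_le {β : ℝ} (hβ : alpha < β) (u : Plane → ℝ) :
    ∑' n, ENNReal.ofReal ((2 : ℝ) ^ β / 3) ^ n * vertexSumLevel u n
      ≤ 37 * discreteEnergy β u := by
  set R := ENNReal.ofReal ((2 : ℝ) ^ β / 3) with hR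
  have hR1 : 1 ≤ R := by
    rw [hR, ENNReal.one_le_ofReal]
    linarith [three_lt_two_rpow hβ]
  rw [tsum_eq_zero_add' ENNReal.summable, discreteEnergy_eq, pow_zero, one_mul]
  have h : vertexSumLevel u 0 ≤ 36 * ∑' n, R ^ (n + 1) * vertexSumLevel u (n + 1) := by
    refine (vertexSumLevel_zero_le u).trans (mul_le_mul_right ?_ _)
    refine le_trans ?_ (ENNReal.le_tsum 0)
    rw [zero_add, pow_one]
    exact le_mul_of_one_le_left' hR1
  calc _ ≤ 36 * (∑' n, R ^ (n + 1) * vertexSumLevel u (n + 1))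
        + ∑' n, R ^ (n + 1) * vertexSumLevel u (n + 1) := by gcongr
    _ = _ := by ring

theorem exists_integralEnergy_le {β : ℝ} (hβ : alpha < β) :
    ∃ C : ℝ≥0∞, C ≠ ∞ ∧ ∀ u : Plane → ℝ, Continuous u →
      integralEnergy β u ≤ C * discreteEnergy β u := by
  have hB := three_lt_two_rpow hβ
  have hγ : 0 < alpha + β := by linarith [alpha_pos]
  -- Any μ strictly between 1 and 2^β = 3R would do; the extra factor 3 compared with the other
  -- direction comes from the cell masses 3^(-(n+j)).
  set μ : ℝ := ((2 : ℝ) ^ β + 1) / 2 with hμdef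
  set R := ENNReal.ofReal ((2 : ℝ) ^ β / 3) with hR
  set Q := ENNReal.ofReal ((2 : ℝ) ^ (alpha + β)) with hQ
  have hμ : 1 < μ := by linarith
  have hμB : μ < (2 : ℝ) ^ β := by linarith
  set ρ : ℝ≥0∞ := ENNReal.ofReal (μ / (2 : ℝ) ^ β) with hρ
  have hρ1 : ρ < 1 := ENNReal.ofReal_lt_one.2 ((div_lt_one (by positivity)).2 hμB)
  have h3 : (3 : ℝ≥0∞) * 3⁻¹ = 1 := ENNReal.mul_inv_cancel (by norm_num) (by norm_num)
  have hρR : ENNReal.ofReal μ = ρ * (3 * R) := by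
    have h : (3 : ℝ≥0∞) = ENNReal.ofReal 3 := by norm_num
    rw [h, ← ENNReal.ofReal_mul (by norm_num), ← ENNReal.ofReal_mul (by positivity)]
    congr 1
    field_simp
  have hQR : Q = 9 * R := (ofReal_div_three_mul_nine β).symm
  set c := ENNReal.ofReal ((1 - μ⁻¹)⁻¹) with hc
  set d := ENNReal.ofReal ((4 : ℝ) ^ (alpha + β)) with hd
  refine ⟨d * (324 * c * ((1 - ρ)⁻¹ * 37)), ?_, fun u hu => ?_⟩
  · have : (1 - ρ)⁻¹ ≠ ∞ := ENNReal.inv_ne_top.2 (tsub_pos_of_lt hρ1).ne'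
    finiteness
  calc integralEnergy β u ≤ d * ∑' n, Q ^ n * adjacentIntegral u n :=
        integralEnergy_le_tsum_adjacentIntegral hγ hu
    _ ≤ d * ∑' n, Q ^ n * (108 * (3 ^ n)⁻¹ * (3 * c * ∑' j, ENNReal.ofReal μ ^ j *
          ((3 ^ (n + j))⁻¹ * vertexSumLevel u (n + j)))) := by
        gcongr with n
        refine (adjacentIntegral_le hu n).trans ?_
        gcongr
        exact sum_cornerIntegral_le hu hμ n
    _ = d * (324 * c * ∑' n, ∑' j, ρ ^ j * (R ^ (n + j) * vertexSumLevel u (n + j))) := by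
        congr 1
        rw [← ENNReal.tsum_mul_left]
        refine tsum_congr fun n => ?_
        have h1 : Q ^ n * (108 * (3 ^ n)⁻¹ * (3 * c * ∑' j, ENNReal.ofReal μ ^ j *
          ((3 ^ (n + j))⁻¹ * vertexSumLevel u (n + j)))) = 324 * c * ((Q ^ n * (3 ^ n)⁻¹) *
          ∑' j, ENNReal.ofReal μ ^ j * ((3 ^ (n + j))⁻¹ * vertexSumLevel u (n + j))) := by ring
        rw [h1, ← ENNReal.tsum_mul_left (a := Q ^ n * (3 ^ n)⁻¹)]
        congr 1
        refine tsum_congr fun j => ?_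
        have h9 : (9 : ℝ≥0∞) = 3 * 3 := by norm_num
        rw [hQR, hρR, h9]
        simp only [ENNReal.inv_pow]
        simp only [pow_add, mul_pow]
        calc _ = ρ ^ j * (R ^ n * R ^ j * vertexSumLevel u (n + j)) *
              ((3 * 3⁻¹) ^ n * (3 * 3⁻¹) ^ n * (3 * 3⁻¹) ^ j) := by ring
          _ = _ := by simp [h3]
    _ ≤ d * (324 * c * ((1 - ρ)⁻¹ * ∑' m, R ^ m * vertexSumLevel u m)) := by
        gcongr
        exact tsum_tsum_pow_mul_le ρ fun m => R ^ m * vertexSumLevel u m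
    _ ≤ d * (324 * c * ((1 - ρ)⁻¹ * (37 * discreteEnergy β u))) := by
        gcongr
        exact tsum_vertexSumLevel_le hβ u
    _ = _ := by ring

end SierpinskiGasket
end

/-- Real functions on the gasket are represented by functions on the plane that are continuous on
the gasket; both energies only involve the values on the gasket. -/
theorem mainTheorem1 (β : ℝ) (hβ : SierpinskiGasket.alpha < β) :
    ∃ C : NNReal, 0 < C ∧
      ∀ u : SierpinskiGasket.Plane → ℝ, ContinuousOn u SierpinskiGasket.gasket →
        SierpinskiGasket.discreteEnergy β u ≤ C * SierpinskiGasket.integralEnergy β u ∧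
        SierpinskiGasket.integralEnergy β u ≤ C * SierpinskiGasket.discreteEnergy β u := by
  obtain ⟨A, hA, hA'⟩ := SierpinskiGasket.exists_discreteEnergy_le hβ
  obtain ⟨B, hB, hB'⟩ := SierpinskiGasket.exists_integralEnergy_le hβ
  lift A to NNReal using hA
  lift B to NNReal using hB
  -- The summand 1 only makes the constant positive.
  refine ⟨A + B + 1, by positivity, fun u hu => ?_⟩
  -- Tietze extension: replace u by a function continuous on the whole plane, for which
  -- measurability and limits are immediate.
  obtain ⟨v, hv⟩ := ContinuousMap.exists_restrict_eq
    SierpinskiGasket.isCompact_gasket.isClosed ⟨_, hu.domRestrict⟩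
  have huv : Set.EqOn u v SierpinskiGasket.gasket := fun x hx =>
    (DFunLike.congr_fun hv ⟨x, hx⟩).symm
  rw [SierpinskiGasket.discreteEnergy_congr β huv, SierpinskiGasket.integralEnergy_congr β huv]
  constructor
  · refine (hA' v v.continuous).trans ?_
    gcongr
    rw [add_assoc]
    exact le_self_add
  · refine (hB' v v.continuous).trans ?_
    gcongr
    exact le_add_self.trans le_self_add
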